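/- Let $p,d\ge 1$ be integers with $n=p+d\ge 3$, let $(\overline M,\overline g)$ and $(\widetilde M,\widetilde g)$ be connected smooth semi-Riemannian manifolds of dimensions $p$ and $d=n-p$, let $f$ be a positive smooth function on $\overline M$, and let $M=\overline M\times_f\widetilde M$ be the warped product, i.e. $\overline M\times\widetilde M$ with the metric $g=\pi^*\overline g+(f\circ\pi)\,\sigma^*\widetilde g$, where $\pi,\sigma$ are the projections. Write $R,S,\kappa$ for the $(0,4)$ Riemann–Christoffel tensor, the Ricci tensor and the scalar curvature of $g$, and mark the corresponding objects of $\overline g$, $\widetilde g$ by a bar or a tilde. For symmetric $(0,2)$-tensors put $$(A\wedge E)(X_1,X_2,Y_1,Y_2)=A(X_1,Y_2)E(X_2,Y_1)+A(X_2,Y_1)E(X_1,Y_2)-A(X_1,Y_1)E(X_2,Y_2)-A(X_2,Y_2)E(X_1,Y_1),$$ the sign of $R$ being such that $R=\frac c2\,g\wedge g$ for constant curvature $c$. A semi-Riemannian manifold is *of Roter type* if $R=N_1\,g\wedge g+N_2\,g\wedge S+N_3\,S\wedge S$ for some real functions $N_1,N_2,N_3$ on it (its associated scalars). A manifold of dimension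 $m\ge3$ is *conformally flat* if its conformal curvature tensor $C=R-\frac1{m-2}\,g\wedge S+\frac{\kappa}{2(m-1)(m-2)}\,g\wedge g$ vanishes; manifolds of dimension at most $2$ are all regarded as conformally flat. A manifold of dimension $m$ is *Einstein* if $S=\frac{\kappa}{m}g$. On $\overline M$ let $$T=-\frac1{2f}\Big(\overline\nabla df-\frac1{2f}\,df\otimes df\Big),\qquad \operatorname{tr}(T)=\overline g^{ab}T_{ab}.$$ Suppose that $M$ is not flat and is of Roter type, $R=N_1\,g\wedge g+N_2\,g\wedge S+N_3\,S\wedge S$, with functions $N_1,N_2,N_3$ on $M$. Then: (i) The fiber $\widetilde M$ is of Roter type; if $N_1,N_2,N_3$ are smooth, its associated scalars can be chosen smooth. (ii) If $M$ is conformally flat, then so is the fiber $\widetilde M$. (iii) Suppose that for every $y\in\widetilde M$ there is an $x\in\overline M$ with $$-2(n-p)\,N_3(x,y)\,\operatorname{tr}(T)(x)-p\,N_2(x,y)-2\,N_3(x,y)\,\overline\kappa(x)\neq0$$ (for instance, that this expression vanishes nowhere on $M$). Then $\widetilde M$ is Einstein and $\widetilde R=\frac c2\,\widetilde g\wedge\widetilde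 g$ for a function $c$ on $\widetilde M$; if moreover $n-p\neq2$, then $\widetilde M$ is of constant curvature, i.e. this holds with $c$ constant. (iv) If $\alpha T+\beta\,\overline g+\gamma\,\overline S=0$ on $\overline M$ for some functions $\alpha,\beta,\gamma$ on $\overline M$ with $\alpha$ nowhere zero, then the base $\overline M$ is of Roter type; if $N_1,N_2,N_3,\alpha,\beta,\gamma$ are smooth, its associated scalars can be chosen smooth. -/

import Mathlib

open scoped Manifold ContDiff

noncomputable section

namespace WarpedRoter

/-! ### Tensor calculus in a coordinate domain

`E` is the coordinate space of a chart and `G u` is the matrix `g_{ij}(u)` of the metric in that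
chart, seen as a bilinear form on `E`; `u` ranges over the image of the chart in `E`. -/

section Coordinates

set_option maxSynthPendingDepth 3

variable {E : Type*} [NormedAddCommGroup E] [NormedSpace ℝ E]

/-- The flip `A ↦ ((v, w) ↦ A w v)` of bilinear forms, as a continuous linear map. -/
def flipForm : (E →L[ℝ] E →L[ℝ] ℝ) →L[ℝ] (E →L[ℝ] E →L[ℝ] ℝ) :=
  ((ContinuousLinearMap.flipₗᵢ ℝ E E ℝ).toContinuousLinearEquiv :
    (E →L[ℝ] E →L[ℝ] ℝ) ≃L[ℝ] (E →L[ℝ] E →L[ℝ] ℝ)).toContinuousLinearMap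

/-- The Christoffel symbols of the first kind, as a trilinear map:
`(v, w, z) ↦ (1/2) (∂_v G(w, z) + ∂_w G(v, z) - ∂_z G(v, w))`. -/
def christoffelFirst (G : E → E →L[ℝ] E →L[ℝ] ℝ) (u : E) : E →L[ℝ] E →L[ℝ] E →L[ℝ] ℝ :=
  (1 / 2 : ℝ) • (fderiv ℝ G u + (fderiv ℝ G u).flip - flipForm.comp (fderiv ℝ G u).flip)

theorem christoffelFirst_apply (G : E → E →L[ℝ] E →L[ℝ] ℝ) (u v w z : E) :
    christoffelFirst G u v w z =
      (1 / 2) * (fderiv ℝ G u v w z + fderiv ℝ G u w v z - fderiv ℝ G u z v w) := by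
  simp [christoffelFirst, flipForm]

/-- The Christoffel symbols (of the second kind) of the Levi-Civita connection:
`christoffel G u v w` is the vector `Γ(v, w)` whose image under `G u` is the linear form
`christoffelFirst G u v w`, that is `Γ^i_{jk} = g^{il} Γ_{jk,l}`. -/
def christoffel (G : E → E →L[ℝ] E →L[ℝ] ℝ) (u : E) : E →L[ℝ] E →L[ℝ] E :=
  (ContinuousLinearMap.compL ℝ E (E →L[ℝ] ℝ) E (ContinuousLinearMap.inverse (G u))).comp
    (christoffelFirst G u)

/-- The curvature operator `X ↦ R(X, Y) Z`, where
`R(X, Y) Z = (∂_X Γ)(Y, Z) - (∂_Y Γ)(X, Z) + Γ(X, Γ(Y, Z)) - Γ(Y, Γ(X, Z))`. -/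
def curvOp (G : E → E →L[ℝ] E →L[ℝ] ℝ) (u Y Z : E) : E →ₗ[ℝ] E where
  toFun X := fderiv ℝ (christoffel G) u X Y Z - fderiv ℝ (christoffel G) u Y X Z
    + christoffel G u X (christoffel G u Y Z) - christoffel G u Y (christoffel G u X Z)
  map_add' X X' := by
    simp only [map_add, _root_.add_apply]
    abel
  map_smul' c X := by
    simp only [map_smul, _root_.smul_apply, RingHom.id_apply, smul_sub, smul_add]

/-- The Riemann-Christoffel tensor `R(X, Y, Z, W) = g(R(X, Y) Z, W)`. -/
def riemann (G : E → E →L[ℝ] E →L[ℝ] ℝ) (u X Y Z W : E) : ℝ :=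
  G u (curvOp G u Y Z X) W

/-- The Ricci tensor `S(Y, Z)`, the trace of `X ↦ R(X, Y) Z`. -/
def ricci (G : E → E →L[ℝ] E →L[ℝ] ℝ) (u : E) : E →ₗ[ℝ] E →ₗ[ℝ] ℝ :=
  LinearMap.mk₂ ℝ (fun Y Z => LinearMap.trace ℝ E (curvOp G u Y Z))
    (fun Y Y' Z => by
      rw [← map_add]; congr 1; ext X
      simp only [curvOp, LinearMap.coe_mk, AddHom.coe_mk, LinearMap.add_apply, map_add,
        _root_.add_apply]
      abel)
    (fun c Y Z => by
      rw [← map_smul]; congr 1; ext X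
      simp only [curvOp, LinearMap.coe_mk, AddHom.coe_mk, LinearMap.smul_apply, map_smul,
        _root_.smul_apply, smul_sub, smul_add])
    (fun Y Z Z' => by
      rw [← map_add]; congr 1; ext X
      simp only [curvOp, LinearMap.coe_mk, AddHom.coe_mk, LinearMap.add_apply, map_add]
      abel)
    (fun c Y Z => by
      rw [← map_smul]; congr 1; ext X
      simp only [curvOp, LinearMap.coe_mk, AddHom.coe_mk, LinearMap.smul_apply, map_smul,
        smul_sub, smul_add])

/-- The metric trace `g^{ij} A_{ij}` of a bilinear form `A`: the trace of the endomorphism `𝒜`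
with `g(𝒜 X, Y) = A(X, Y)`. -/
def metricTrace [FiniteDimensional ℝ E] (G : E → E →L[ℝ] E →L[ℝ] ℝ) (u : E)
    (A : E →ₗ[ℝ] E →ₗ[ℝ] ℝ) : ℝ :=
  LinearMap.trace ℝ E
    ((ContinuousLinearMap.inverse (G u) : (E →L[ℝ] ℝ) →ₗ[ℝ] E) ∘ₗ
      (LinearMap.toContinuousLinearMap : (E →ₗ[ℝ] ℝ) ≃ₗ[ℝ] (E →L[ℝ] ℝ)).toLinearMap ∘ₗ A)

/-- The scalar curvature. -/
def scalarCurv [FiniteDimensional ℝ E] (G : E → E →L[ℝ] E →L[ℝ] ℝ) (u : E) : ℝ :=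
  metricTrace G u (ricci G u)

/-- The metric at `u` as a bilinear form. -/
def met (G : E → E →L[ℝ] E →L[ℝ] ℝ) (u : E) : E →ₗ[ℝ] E →ₗ[ℝ] ℝ :=
  LinearMap.mk₂ ℝ (fun X Y => G u X Y) (by simp) (by simp) (by simp) (by simp)

/-- The Kulkarni-Nomizu product `(A ∧ B)(X₁, X₂, Y₁, Y₂)` of two bilinear forms. -/
def kn (A B : E →ₗ[ℝ] E →ₗ[ℝ] ℝ) (X₁ X₂ Y₁ Y₂ : E) : ℝ :=
  A X₁ Y₂ * B X₂ Y₁ + A X₂ Y₁ * B X₁ Y₂ - A X₁ Y₁ * B X₂ Y₂ - A X₂ Y₂ * B X₁ Y₁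

/-- The conformal curvature tensor
`C = R - (1/(n-2)) g ∧ S + (κ/(2(n-1)(n-2))) g ∧ g`, with `n = dim E` (used for `n ≥ 3`). -/
def conformalCurv [FiniteDimensional ℝ E] (G : E → E →L[ℝ] E →L[ℝ] ℝ) (u X Y Z W : E) : ℝ :=
  riemann G u X Y Z W
    - 1 / ((Module.finrank ℝ E : ℝ) - 2) * kn (met G u) (ricci G u) X Y Z W
    + scalarCurv G u /
        (2 * ((Module.finrank ℝ E : ℝ) - 1) * ((Module.finrank ℝ E : ℝ) - 2))
      * kn (met G u) (met G u) X Y Z W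

/-- The tensor `T = -(1/(2f)) (∇df - (1/(2f)) df ⊗ df)` of a function `f`, where
`(∇df)(v, w) = ∂_v ∂_w f - df(Γ(v, w))`. -/
def warpTensor (G : E → E →L[ℝ] E →L[ℝ] ℝ) (f : E → ℝ) (u : E) : E →ₗ[ℝ] E →ₗ[ℝ] ℝ :=
  LinearMap.mk₂ ℝ
    (fun v w => -(1 / (2 * f u)) *
      (fderiv ℝ (fderiv ℝ f) u v w - fderiv ℝ f u (christoffel G u v w)
        - 1 / (2 * f u) * (fderiv ℝ f u v * fderiv ℝ f u w)))
    (by intros; simp only [map_add, _root_.add_apply]; ring)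
    (by intros; simp only [map_smul, _root_.smul_apply, smul_eq_mul]; ring)
    (by intros; simp only [map_add]; ring)
    (by intros; simp only [map_smul, smul_eq_mul]; ring)

end Coordinates

/-! ### Semi-Riemannian manifolds

A `(0,2)` tensor field on `M` is a family of bilinear forms on the tangent spaces.  An identity
between tensor fields is expressed by the same identity between their components in every chart of
the atlas of `M`, at every point of the image of the chart. -/

section Manifolds

variable {E : Type*} [NormedAddCommGroup E] [NormedSpace ℝ E]
  {H : Type*} [TopologicalSpace H] (I : ModelWithCorners ℝ E H)
  {M : Type*} [TopologicalSpace M] [ChartedSpace H M]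

/-- The components, in the chart `e`, of the `(0,2)` tensor field `g` : the pullback of `g` under
the inverse of the chart. -/
def inChart (g : (x : M) → TangentSpace I x →L[ℝ] TangentSpace I x →L[ℝ] ℝ)
    (e : OpenPartialHomeomorph M H) (u : E) : E →L[ℝ] E →L[ℝ] ℝ :=
  ContinuousLinearMap.bilinearComp (E := E) (F := E)
    (g ((e.extend I).symm u) : E →L[ℝ] E →L[ℝ] ℝ)
    (mfderiv 𝓘(ℝ, E) I (e.extend I).symm u : E →L[ℝ] E)
    (mfderiv 𝓘(ℝ, E) I (e.extend I).symm u : E →L[ℝ] E)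

/-- `g` is a (smooth) semi-Riemannian metric on `M`, of arbitrary signature. -/
structure IsSemiRiemannian
    (g : (x : M) → TangentSpace I x →L[ℝ] TangentSpace I x →L[ℝ] ℝ) : Prop where
  symm : ∀ (x : M) (v w : TangentSpace I x), g x v w = g x w v
  nondegenerate : ∀ (x : M) (v : TangentSpace I x), (∀ w, g x v w = 0) → v = 0
  smooth : ∀ e ∈ atlas H M, ContDiffOn ℝ ∞ (inChart I g e) (e.extend I).target

/-- The curvature tensor vanishes identically. -/
def IsFlat (g : (x : M) → TangentSpace I x →L[ℝ] TangentSpace I x →L[ℝ] ℝ) : Prop :=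
  ∀ e ∈ atlas H M, ∀ u ∈ (e.extend I).target, ∀ X Y Z W : E,
    riemann (inChart I g e) u X Y Z W = 0

/-- The Roter type condition `R = N₁ g ∧ g + N₂ g ∧ S + N₃ S ∧ S` with associated scalars
`N₁`, `N₂`, `N₃`. -/
def IsRoterTypeWith (g : (x : M) → TangentSpace I x →L[ℝ] TangentSpace I x →L[ℝ] ℝ)
    (N₁ N₂ N₃ : M → ℝ) : Prop :=
  ∀ e ∈ atlas H M, ∀ u ∈ (e.extend I).target, ∀ X Y Z W : E,
    riemann (inChart I g e) u X Y Z W =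
      N₁ ((e.extend I).symm u) * kn (met (inChart I g e) u) (met (inChart I g e) u) X Y Z W
      + N₂ ((e.extend I).symm u) * kn (met (inChart I g e) u) (ricci (inChart I g e) u) X Y Z W
      + N₃ ((e.extend I).symm u) *
          kn (ricci (inChart I g e) u) (ricci (inChart I g e) u) X Y Z W

/-- Conformal flatness: the conformal curvature tensor vanishes.  Manifolds of dimension at most
`2`, for which this tensor is not defined, are all conformally flat. -/
def IsConformallyFlat [FiniteDimensional ℝ E]
    (g : (x : M) → TangentSpace I x →L[ℝ] TangentSpace I x →L[ℝ] ℝ) : Prop :=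
  3 ≤ Module.finrank ℝ E → ∀ e ∈ atlas H M, ∀ u ∈ (e.extend I).target, ∀ X Y Z W : E,
    conformalCurv (inChart I g e) u X Y Z W = 0

/-- `R = c G` with `G = (1/2) g ∧ g` and a function `c`: at each point, all sectional curvatures
have the same value `c`. -/
def HasCurvature (g : (x : M) → TangentSpace I x →L[ℝ] TangentSpace I x →L[ℝ] ℝ)
    (c : M → ℝ) : Prop :=
  ∀ e ∈ atlas H M, ∀ u ∈ (e.extend I).target, ∀ X Y Z W : E,
    riemann (inChart I g e) u X Y Z W =
      c ((e.extend I).symm u) *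
        (1 / 2 * kn (met (inChart I g e) u) (met (inChart I g e) u) X Y Z W)

/-- The manifold is of constant curvature: `R = c G` with a constant `c`. -/
def IsConstantCurvature (g : (x : M) → TangentSpace I x →L[ℝ] TangentSpace I x →L[ℝ] ℝ) : Prop :=
  ∃ c : ℝ, HasCurvature I g (fun _ => c)

/-- The Einstein metric condition `S = (κ/n) g`, with `n = dim M ≥ 1`. -/
def IsEinstein [FiniteDimensional ℝ E]
    (g : (x : M) → TangentSpace I x →L[ℝ] TangentSpace I x →L[ℝ] ℝ) : Prop :=
  ∀ e ∈ atlas H M, ∀ u ∈ (e.extend I).target, ∀ X Y : E,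
    ricci (inChart I g e) u X Y =
      scalarCurv (inChart I g e) u / (Module.finrank ℝ E : ℝ) * inChart I g e u X Y

/-- The scalar curvature at `x`, computed in the preferred chart at `x`. -/
def scalarCurvAt [FiniteDimensional ℝ E]
    (g : (x : M) → TangentSpace I x →L[ℝ] TangentSpace I x →L[ℝ] ℝ) (x : M) : ℝ :=
  scalarCurv (inChart I g (chartAt H x)) (extChartAt I x x)

/-- The trace `tr(T)` at `x` of the tensor `T` of `f`, computed in the preferred chart at `x`. -/
def trWarpAt [FiniteDimensional ℝ E]
    (g : (x : M) → TangentSpace I x →L[ℝ] TangentSpace I x →L[ℝ] ℝ) (f : M → ℝ) (x : M) : ℝ :=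
  metricTrace (inChart I g (chartAt H x)) (extChartAt I x x)
    (warpTensor (inChart I g (chartAt H x)) (f ∘ (extChartAt I x).symm) (extChartAt I x x))

/-- The linear relation `α T + β g + γ S = 0`, where `T` is the tensor of the function `f`. -/
def WarpRelation (g : (x : M) → TangentSpace I x →L[ℝ] TangentSpace I x →L[ℝ] ℝ)
    (f α β γ : M → ℝ) : Prop :=
  ∀ e ∈ atlas H M, ∀ u ∈ (e.extend I).target, ∀ X Y : E,
    α ((e.extend I).symm u) * warpTensor (inChart I g e) (f ∘ (e.extend I).symm) u X Y
      + β ((e.extend I).symm u) * inChart I g e u X Y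
      + γ ((e.extend I).symm u) * ricci (inChart I g e) u X Y = 0

end Manifolds

/-! ### Warped products -/

section WarpedProduct

variable {E₁ : Type*} [NormedAddCommGroup E₁] [NormedSpace ℝ E₁]
  {H₁ : Type*} [TopologicalSpace H₁] (I₁ : ModelWithCorners ℝ E₁ H₁)
  {B : Type*} [TopologicalSpace B] [ChartedSpace H₁ B]
  {E₂ : Type*} [NormedAddCommGroup E₂] [NormedSpace ℝ E₂]
  {H₂ : Type*} [TopologicalSpace H₂] (I₂ : ModelWithCorners ℝ E₂ H₂)
  {F : Type*} [TopologicalSpace F] [ChartedSpace H₂ F]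

/-- The warped product metric `π^* gB + (f ∘ π) σ^* gF` on `B × F`, where `π` and `σ` are the
projections. -/
def warpedMetric (gB : (x : B) → TangentSpace I₁ x →L[ℝ] TangentSpace I₁ x →L[ℝ] ℝ) (f : B → ℝ)
    (gF : (y : F) → TangentSpace I₂ y →L[ℝ] TangentSpace I₂ y →L[ℝ] ℝ) (z : B × F) :
    TangentSpace (I₁.prod I₂) z →L[ℝ] TangentSpace (I₁.prod I₂) z →L[ℝ] ℝ :=
  (ContinuousLinearMap.bilinearComp (E := E₁) (F := E₁) (gB z.1 : E₁ →L[ℝ] E₁ →L[ℝ] ℝ)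
      (mfderiv (I₁.prod I₂) I₁ (Prod.fst : B × F → B) z : E₁ × E₂ →L[ℝ] E₁)
      (mfderiv (I₁.prod I₂) I₁ (Prod.fst : B × F → B) z : E₁ × E₂ →L[ℝ] E₁) +
    f z.1 • ContinuousLinearMap.bilinearComp (E := E₂) (F := E₂)
      (gF z.2 : E₂ →L[ℝ] E₂ →L[ℝ] ℝ)
      (mfderiv (I₁.prod I₂) I₂ (Prod.snd : B × F → F) z : E₁ × E₂ →L[ℝ] E₂)
      (mfderiv (I₁.prod I₂) I₂ (Prod.snd : B × F → F) z : E₁ × E₂ →L[ℝ] E₂) :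
    E₁ × E₂ →L[ℝ] E₁ × E₂ →L[ℝ] ℝ)

end WarpedProduct

end WarpedRoter

end

/-! In product coordinates the metric is $g = \bar g + f\,\tilde h$, with $\tilde h$ the fiber
metric. Set $\nu = |df|^2/(4f)$ and $q = f\,\mathrm{tr}\,T - (d-1)\nu$. The curvature formulas of a
warped product show that $R$ is $\bar R$ on base vectors, $f(\tilde R - \frac{\nu}{2}\tilde
h\wedge\tilde h)$ on fiber vectors, and $f\,T\otimes\tilde h$ on two base and two fiber vectors, up
to order and sign. The Ricci tensor splits as $(\bar S + dT)\oplus(\tilde S + q\tilde h)$.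

The whole theorem is read off from these blocks of the Roter identity. The fiber block at a fixed
base point is a Roter identity for $\tilde h$ (`roterAt_fiber`), which gives (i). The base block at
a fixed fiber point is one for $\bar g$ as soon as $\bar S + dT$ is a combination of $\bar g$ and
$\bar S$ (`roterAt_base`), which gives (iv). The mixed block, traced over the base, is a linear
equation for $\tilde S$ whose leading coefficient is the expression in (iii) up to sign
(`ricci_fiber_eq`). Where it is nonzero, $\tilde S$ is a multiple of $\tilde h$, so $\tilde R$ is
one of $\tilde h\wedge\tilde h$, and Schur's lemma makes the factor constant for $d\ge3$.

For (ii), vanishing of $C$ is a Roter identity with $N_3=0$ and $N_2=1/(n-2)$. The fiber inherits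
the coefficient $1/(n-2)\ne1/(d-2)$, so contracting again makes $\tilde S$ a multiple of $\tilde h$
(`ricci_of_riemann_eq_add`). -/

noncomputable section

namespace WarpedRoter

/-! ### Levi-Civita calculus and Ricci contractions in a coordinate domain. -/

section CoordinateMetrics

set_option maxSynthPendingDepth 3

variable {E : Type*} [NormedAddCommGroup E] [NormedSpace ℝ E]

/-- `G` gives the components of a smooth semi-Riemannian metric on the open set `U`. -/
structure IsCoordMetric (G : E → E →L[ℝ] E →L[ℝ] ℝ) (U : Set E) : Prop where
  isOpen : IsOpen U
  contDiffOn : ContDiffOn ℝ ∞ G U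
  symm : ∀ u ∈ U, ∀ v w, G u v w = G u w v
  nondegenerate : ∀ u ∈ U, ∀ v, (∀ w, G u v w = 0) → v = 0

theorem met_apply (G : E → E →L[ℝ] E →L[ℝ] ℝ) (u X Y : E) : met G u X Y = G u X Y := rfl

theorem curvOp_apply (G : E → E →L[ℝ] E →L[ℝ] ℝ) (u Y Z X : E) :
    curvOp G u Y Z X = fderiv ℝ (christoffel G) u X Y Z - fderiv ℝ (christoffel G) u Y X Z
      + christoffel G u X (christoffel G u Y Z) - christoffel G u Y (christoffel G u X Z) := rfl

theorem riemann_zero_first (G : E → E →L[ℝ] E →L[ℝ] ℝ) (u Y Z W : E) :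
    riemann G u 0 Y Z W = 0 := by
  simp [riemann]

theorem riemann_zero_third (G : E → E →L[ℝ] E →L[ℝ] ℝ) (u X Y W : E) :
    riemann G u X Y 0 W = 0 := by
  simp [riemann, curvOp_apply]

theorem ricci_apply (G : E → E →L[ℝ] E →L[ℝ] ℝ) (u Y Z : E) :
    ricci G u Y Z = LinearMap.trace ℝ E (curvOp G u Y Z) := rfl

theorem warpTensor_apply (G : E → E →L[ℝ] E →L[ℝ] ℝ) (f : E → ℝ) (u v w : E) :
    warpTensor G f u v w = -(1 / (2 * f u)) *
      (fderiv ℝ (fderiv ℝ f) u v w - fderiv ℝ f u (christoffel G u v w)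
        - 1 / (2 * f u) * (fderiv ℝ f u v * fderiv ℝ f u w)) := rfl

variable [FiniteDimensional ℝ E]

/-- `ContinuousLinearMap.inverse` is zero on non-invertible maps. This is what makes it raise
indices in `christoffel` and `metricTrace`. -/
theorem isInvertible_of_nondegenerate {b : E →L[ℝ] E →L[ℝ] ℝ}
    (hb : ∀ v, (∀ w, b v w = 0) → v = 0) : b.IsInvertible := by
  have hinj : Function.Injective (b : E →ₗ[ℝ] E →L[ℝ] ℝ) := by
    rw [← LinearMap.ker_eq_bot, LinearMap.ker_eq_bot']
    intro v hv
    exact hb v fun w => by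
      have : b v = 0 := hv
      simp [this]
  have hdim : Module.finrank ℝ E = Module.finrank ℝ (E →L[ℝ] ℝ) := by
    rw [← (LinearMap.toContinuousLinearMap : (E →ₗ[ℝ] ℝ) ≃ₗ[ℝ] (E →L[ℝ] ℝ)).finrank_eq]
    exact (Subspace.dual_finrank_eq (K := ℝ) (V := E)).symm
  refine ⟨(LinearEquiv.ofInjectiveOfFinrankEq _ hinj hdim).toContinuousLinearEquiv, ?_⟩
  ext v w
  rfl

/-- The endomorphism obtained by raising the second index of a bilinear form. -/
def sharp (G : E → E →L[ℝ] E →L[ℝ] ℝ) (u : E) (A : E →ₗ[ℝ] E →ₗ[ℝ] ℝ) : E →ₗ[ℝ] E :=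
  (ContinuousLinearMap.inverse (G u) : (E →L[ℝ] ℝ) →ₗ[ℝ] E) ∘ₗ
    (LinearMap.toContinuousLinearMap : (E →ₗ[ℝ] ℝ) ≃ₗ[ℝ] (E →L[ℝ] ℝ)).toLinearMap ∘ₗ A

theorem metricTrace_eq_trace_sharp (G : E → E →L[ℝ] E →L[ℝ] ℝ) (u : E)
    (A : E →ₗ[ℝ] E →ₗ[ℝ] ℝ) : metricTrace G u A = LinearMap.trace ℝ E (sharp G u A) := rfl

theorem metricTrace_add (G : E → E →L[ℝ] E →L[ℝ] ℝ) (u : E) (A B : E →ₗ[ℝ] E →ₗ[ℝ] ℝ) :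
    metricTrace G u (A + B) = metricTrace G u A + metricTrace G u B := by
  simp only [metricTrace, LinearMap.comp_add, map_add]

theorem metricTrace_smul (G : E → E →L[ℝ] E →L[ℝ] ℝ) (u : E) (c : ℝ)
    (A : E →ₗ[ℝ] E →ₗ[ℝ] ℝ) : metricTrace G u (c • A) = c * metricTrace G u A := by
  simp only [metricTrace, LinearMap.comp_smul, map_smul, smul_eq_mul]

/-- The gradient of `f` with respect to `G`. -/
def coordGradient (G : E → E →L[ℝ] E →L[ℝ] ℝ) (f : E → ℝ) (u : E) : E :=
  ContinuousLinearMap.inverse (G u) (fderiv ℝ f u)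

namespace IsCoordMetric

variable {G : E → E →L[ℝ] E →L[ℝ] ℝ} {U : Set E} {u : E}

theorem isInvertible (hG : IsCoordMetric G U) (hu : u ∈ U) : (G u).IsInvertible :=
  isInvertible_of_nondegenerate (hG.nondegenerate u hu)

theorem ext (hG : IsCoordMetric G U) (hu : u ∈ U) {v w : E} (h : ∀ z, G u v z = G u w z) :
    v = w :=
  (hG.isInvertible hu).injective (ContinuousLinearMap.ext h)

omit [FiniteDimensional ℝ E] in
theorem contDiffAt (hG : IsCoordMetric G U) (hu : u ∈ U) : ContDiffAt ℝ ∞ G u :=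
  hG.contDiffOn.contDiffAt (hG.isOpen.mem_nhds hu)

omit [FiniteDimensional ℝ E] in
theorem differentiableAt (hG : IsCoordMetric G U) (hu : u ∈ U) : DifferentiableAt ℝ G u :=
  (hG.contDiffAt hu).differentiableAt (by simp)

theorem apply_sharp (hG : IsCoordMetric G U) (hu : u ∈ U) (A : E →ₗ[ℝ] E →ₗ[ℝ] ℝ) (v w : E) :
    G u (sharp G u A v) w = A v w := by
  simp only [sharp, LinearMap.comp_apply, ContinuousLinearMap.coe_coe, LinearEquiv.coe_coe,
    (hG.isInvertible hu).self_apply_inverse, LinearMap.coe_toContinuousLinearMap']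

theorem apply_coordGradient (hG : IsCoordMetric G U) (hu : u ∈ U) (f : E → ℝ) (w : E) :
    G u (coordGradient G f u) w = fderiv ℝ f u w := by
  rw [coordGradient, (hG.isInvertible hu).self_apply_inverse]

theorem apply_christoffel (hG : IsCoordMetric G U) (hu : u ∈ U) (v w z : E) :
    G u (christoffel G u v w) z =
      (1 / 2) * (fderiv ℝ G u v w z + fderiv ℝ G u w v z - fderiv ℝ G u z v w) := by
  rw [← christoffelFirst_apply]
  simp [christoffel, (hG.isInvertible hu).self_apply_inverse]

omit [FiniteDimensional ℝ E] in
theorem fderiv_symm (hG : IsCoordMetric G U) (hu : u ∈ U) (v w z : E) :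
    fderiv ℝ G u v w z = fderiv ℝ G u v z w := by
  have h := hG.differentiableAt hu
  have h1 : HasFDerivAt (fun x => G x w z) _ u :=
    (h.hasFDerivAt.clm_apply (hasFDerivAt_const w u)).clm_apply (hasFDerivAt_const z u)
  have h2 : HasFDerivAt (fun x => G x z w) _ u :=
    (h.hasFDerivAt.clm_apply (hasFDerivAt_const z u)).clm_apply (hasFDerivAt_const w u)
  have h3 := h2.congr_of_eventuallyEq (f₁ := fun x => G x w z)
    ((hG.isOpen.eventually_mem hu).mono fun x hx => hG.symm x hx w z)
  simpa using congrArg (fun L => L v) (h1.unique h3)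

theorem christoffel_symm (hG : IsCoordMetric G U) (hu : u ∈ U) (v w : E) :
    christoffel G u v w = christoffel G u w v :=
  hG.ext hu fun z => by
    rw [hG.apply_christoffel hu, hG.apply_christoffel hu, hG.fderiv_symm hu z v w]
    ring

/-- Metric compatibility $\nabla G = 0$, the form in which derivatives of the metric are eliminated
below. -/
theorem fderiv_eq (hG : IsCoordMetric G U) (hu : u ∈ U) (v w z : E) :
    fderiv ℝ G u v w z = G u (christoffel G u v w) z + G u w (christoffel G u v z) := by
  rw [hG.symm u hu w, hG.apply_christoffel hu, hG.apply_christoffel hu,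
    hG.fderiv_symm hu z v w, hG.fderiv_symm hu w v z, hG.fderiv_symm hu v z w]
  ring

theorem contDiffAt_inverse (hG : IsCoordMetric G U) (hu : u ∈ U) :
    ContDiffAt ℝ ∞ (fun x => ContinuousLinearMap.inverse (G x)) u :=
  ContDiffAt.comp u (g := ContinuousLinearMap.inverse)
    ((hG.isInvertible hu).contDiffAt_map_inverse) (hG.contDiffAt hu)

theorem contDiffAt_christoffel (hG : IsCoordMetric G U) (hu : u ∈ U) :
    ContDiffAt ℝ ∞ (christoffel G) u := by
  have h1 : ContDiffAt ℝ ∞ (fderiv ℝ G) u := (hG.contDiffAt hu).fderiv_right (by simp)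
  have h2 : ContDiffAt ℝ ∞ (christoffelFirst G) u := by
    have hflip : ContDiffAt ℝ ∞ (fun x => (fderiv ℝ G x).flip) u :=
      ((ContinuousLinearMap.flipₗᵢ ℝ E E (E →L[ℝ] ℝ)).toContinuousLinearEquiv
        |>.contDiff.contDiffAt).comp u h1
    exact ((h1.add hflip).sub (contDiffAt_const.clm_comp hflip)).const_smul _
  exact ((ContinuousLinearMap.compL ℝ E (E →L[ℝ] ℝ) E).contDiff.contDiffAt.comp u
    (hG.contDiffAt_inverse hu)).clm_comp h2

theorem differentiableAt_christoffel (hG : IsCoordMetric G U) (hu : u ∈ U) :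
    DifferentiableAt ℝ (christoffel G) u :=
  (hG.contDiffAt_christoffel hu).differentiableAt (by simp)

theorem hasFDerivAt_christoffel_apply (hG : IsCoordMetric G U) (hu : u ∈ U) (v w : E) :
    HasFDerivAt (fun x => christoffel G x v w)
      (((fderiv ℝ (christoffel G) u).flip v).flip w) u := by
  convert! ((hG.differentiableAt_christoffel hu).hasFDerivAt.clm_apply
    (hasFDerivAt_const v u)).clm_apply (hasFDerivAt_const w u) using 1
  ext z
  simp

omit [FiniteDimensional ℝ E] in
theorem hasFDerivAt_apply (hG : IsCoordMetric G U) (hu : u ∈ U) (v w : E) :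
    HasFDerivAt (fun x => G x v w) (((fderiv ℝ G u).flip v).flip w) u := by
  convert! ((hG.differentiableAt hu).hasFDerivAt.clm_apply
    (hasFDerivAt_const v u)).clm_apply (hasFDerivAt_const w u) using 1
  ext z
  simp

theorem differentiableAt_coordGradient (hG : IsCoordMetric G U) (hu : u ∈ U) {f : E → ℝ}
    (hf : ContDiffAt ℝ ∞ f u) : DifferentiableAt ℝ (coordGradient G f) u :=
  (ContDiffAt.clm_apply (hG.contDiffAt_inverse hu)
    (hf.fderiv_right (m := ∞) (by simp))).differentiableAt (by simp)

/-- The covariant derivative of the gradient is the Hessian with an index raised. -/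
theorem apply_nabla_coordGradient (hG : IsCoordMetric G U) (hu : u ∈ U) {f : E → ℝ}
    (hf : ContDiffAt ℝ ∞ f u) (v w : E) :
    G u (fderiv ℝ (coordGradient G f) u v + christoffel G u v (coordGradient G f u)) w =
      fderiv ℝ (fderiv ℝ f) u v w - fderiv ℝ f u (christoffel G u v w) := by
  -- Both sides of $G(\mathrm{grad} f, w) = df(w)$ are differentiated, and $\nabla G = 0$ removes
  -- the derivative of $G$.
  have h1 : HasFDerivAt (fun x => G x (coordGradient G f x) w) _ u :=
    ((hG.differentiableAt hu).hasFDerivAt.clm_apply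
      (hG.differentiableAt_coordGradient hu hf).hasFDerivAt).clm_apply (hasFDerivAt_const w u)
  have h2 : HasFDerivAt (fun x => fderiv ℝ f x w) _ u :=
    (((hf.fderiv_right (m := ∞) (by simp)).differentiableAt (by simp)).hasFDerivAt).clm_apply
      (hasFDerivAt_const w u)
  have h3 := h2.congr_of_eventuallyEq (f₁ := fun x => G x (coordGradient G f x) w)
    ((hG.isOpen.eventually_mem hu).mono fun x hx => hG.apply_coordGradient hx f w)
  have h4 := congrArg (fun L => L v) (h1.unique h3)
  simp [hG.fderiv_eq hu] at h4
  rw [← hG.apply_coordGradient hu f (christoffel G u v w)]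
  simp
  linarith

theorem metricTrace_met (hG : IsCoordMetric G U) (hu : u ∈ U) :
    metricTrace G u (met G u) = Module.finrank ℝ E := by
  have : sharp G u (met G u) = LinearMap.id :=
    LinearMap.ext fun v => hG.ext hu fun z => by rw [hG.apply_sharp hu]; rfl
  rw [metricTrace_eq_trace_sharp, this, LinearMap.trace_id]

theorem curvOp_of_riemann_eq (hG : IsCoordMetric G U) (hu : u ∈ U) {c : ℝ}
    (h : ∀ X Y Z W, riemann G u X Y Z W = c * (1 / 2 * kn (met G u) (met G u) X Y Z W))
    (X Y Z : E) : curvOp G u Y Z X = c • (G u Y Z • X - G u X Z • Y) := by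
  refine hG.ext hu fun W => ?_
  have := h X Y Z W
  simp only [riemann, kn, met_apply] at this
  rw [this]
  simp only [map_smul, map_sub, _root_.smul_apply, _root_.sub_apply, smul_eq_mul]
  ring

/-- A metric with `R = c G` has Ricci tensor `(n - 1) c g`. -/
theorem ricci_of_riemann_eq (hG : IsCoordMetric G U) (hu : u ∈ U) {c : ℝ}
    (h : ∀ X Y Z W, riemann G u X Y Z W = c * (1 / 2 * kn (met G u) (met G u) X Y Z W)) :
    ricci G u = (c * (Module.finrank ℝ E - 1)) • met G u := by
  ext Y Z
  have : curvOp G u Y Z =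
      c • (G u Y Z • LinearMap.id - ((met G u).flip Z).smulRight Y) :=
    LinearMap.ext fun X => by
      rw [hG.curvOp_of_riemann_eq hu h]
      simp [met_apply]
  rw [ricci_apply, this]
  simp [met_apply]
  ring

/-- If `R` is a combination of `g ∧ g` and `g ∧ S`, and the coefficient of the latter is not the
one of the conformal curvature tensor, then the Ricci tensor is a multiple of the metric. -/
theorem ricci_of_riemann_eq_add (hG : IsCoordMetric G U) (hu : u ∈ U) {k l : ℝ}
    (h : ∀ X Y Z W, riemann G u X Y Z W =
      k * kn (met G u) (met G u) X Y Z W + l * kn (met G u) (ricci G u) X Y Z W)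
    (hl : l * (Module.finrank ℝ E - 2) ≠ 1) :
    ∃ c : ℝ, ricci G u = c • met G u := by
  set S := ricci G u with hS
  -- Contracting the hypothesis: $g\wedge g$ gives $2(n-1)g$ and $g\wedge S$ gives $(n-2)S + \kappa
  -- g$.
  have key : ∀ Y Z, S Y Z * (1 - l * (Module.finrank ℝ E - 2)) =
      (2 * k * (Module.finrank ℝ E - 1) + l * metricTrace G u S) * G u Y Z := by
    intro Y Z
    -- As an endomorphism in $X$, the curvature is a sum of multiples of the identity, of `sharp G u
    -- S` and of rank-one maps, whose traces are known.
    have : curvOp G u Y Z =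
        (2 * k) • (G u Y Z • LinearMap.id - ((met G u).flip Z).smulRight Y)
        + l • (S Y Z • LinearMap.id + G u Y Z • sharp G u S
          - (S.flip Z).smulRight Y - ((met G u).flip Z).smulRight (sharp G u S Y)) := by
      refine LinearMap.ext fun X => hG.ext hu fun W => ?_
      have := h X Y Z W
      simp only [riemann, kn, met_apply] at this
      rw [this]
      simp [hG.apply_sharp hu, met_apply]
      ring
    have h2 : S Y Z = _ := (ricci_apply G u Y Z).trans (congrArg _ this)
    simp [met_apply, hG.apply_sharp hu, ← metricTrace_eq_trace_sharp] at h2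
    linear_combination h2
  refine ⟨(2 * k * (Module.finrank ℝ E - 1) + l * metricTrace G u S) /
    (1 - l * (Module.finrank ℝ E - 2)), ?_⟩
  ext Y Z
  have hne : 1 - l * ((Module.finrank ℝ E : ℝ) - 2) ≠ 0 := sub_ne_zero.mpr (Ne.symm hl)
  simp only [LinearMap.smul_apply, met_apply, smul_eq_mul]
  rw [div_mul_eq_mul_div, eq_div_iff hne, key]

end IsCoordMetric

end CoordinateMetrics

/-! ### Connection and curvature of a warped product in product coordinates. -/

section WarpedCoordinates

set_option maxSynthPendingDepth 3

variable {E₁ : Type*} [NormedAddCommGroup E₁] [NormedSpace ℝ E₁]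
  {E₂ : Type*} [NormedAddCommGroup E₂] [NormedSpace ℝ E₂]

/-- The components of a warped product metric in product coordinates. -/
def warpedCoord (g : E₁ → E₁ →L[ℝ] E₁ →L[ℝ] ℝ) (f : E₁ → ℝ) (h : E₂ → E₂ →L[ℝ] E₂ →L[ℝ] ℝ)
    (z : E₁ × E₂) : E₁ × E₂ →L[ℝ] E₁ × E₂ →L[ℝ] ℝ :=
  ContinuousLinearMap.bilinearComp (g z.1) (ContinuousLinearMap.fst ℝ E₁ E₂)
      (ContinuousLinearMap.fst ℝ E₁ E₂)
    + f z.1 • ContinuousLinearMap.bilinearComp (h z.2) (ContinuousLinearMap.snd ℝ E₁ E₂)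
      (ContinuousLinearMap.snd ℝ E₁ E₂)

theorem warpedCoord_apply (g : E₁ → E₁ →L[ℝ] E₁ →L[ℝ] ℝ) (f : E₁ → ℝ)
    (h : E₂ → E₂ →L[ℝ] E₂ →L[ℝ] ℝ) (z X Y : E₁ × E₂) :
    warpedCoord g f h z X Y = g z.1 X.1 Y.1 + f z.1 * h z.2 X.2 Y.2 := by
  simp [warpedCoord]

/-- Pullback of bilinear forms, as a continuous linear map. -/
def pullbackForm {E F : Type*} [NormedAddCommGroup E] [NormedSpace ℝ E] [NormedAddCommGroup F]
    [NormedSpace ℝ F] (L : F →L[ℝ] E) : (E →L[ℝ] E →L[ℝ] ℝ) →L[ℝ] (F →L[ℝ] F →L[ℝ] ℝ) :=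
  (ContinuousLinearMap.compL ℝ F (E →L[ℝ] ℝ) (F →L[ℝ] ℝ)
      ((ContinuousLinearMap.compL ℝ F E ℝ).flip L)).comp
    ((ContinuousLinearMap.compL ℝ F E (E →L[ℝ] ℝ)).flip L)

section

variable {g : E₁ → E₁ →L[ℝ] E₁ →L[ℝ] ℝ} {f : E₁ → ℝ} {h : E₂ → E₂ →L[ℝ] E₂ →L[ℝ] ℝ}
  {U : Set E₁} {V : Set E₂}

theorem isCoordMetric_warpedCoord (hg : IsCoordMetric g U) (hf : ContDiffOn ℝ ∞ f U)
    (hpos : ∀ u ∈ U, f u ≠ 0) (hh : IsCoordMetric h V) :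
    IsCoordMetric (warpedCoord g f h) (U ×ˢ V) where
  isOpen := hg.isOpen.prod hh.isOpen
  contDiffOn := by
    have h1 : ContDiffOn ℝ ∞ (fun z : E₁ × E₂ => g z.1) (U ×ˢ V) :=
      hg.contDiffOn.comp contDiffOn_fst fun _ hz => hz.1
    have h2 : ContDiffOn ℝ ∞ (fun z : E₁ × E₂ => h z.2) (U ×ˢ V) :=
      hh.contDiffOn.comp contDiffOn_snd fun _ hz => hz.2
    have h3 : ContDiffOn ℝ ∞ (fun z : E₁ × E₂ => f z.1) (U ×ˢ V) :=
      hf.comp contDiffOn_fst fun _ hz => hz.1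
    exact (contDiffOn_const (c := pullbackForm (ContinuousLinearMap.fst ℝ E₁ E₂)) |>.clm_apply
      h1).add (h3.smul (contDiffOn_const (c := pullbackForm (ContinuousLinearMap.snd ℝ E₁ E₂))
        |>.clm_apply h2))
  symm z hz X Y := by
    rw [warpedCoord_apply, warpedCoord_apply, hg.symm _ hz.1, hh.symm _ hz.2]
  nondegenerate z hz X hX := by
    refine Prod.ext (hg.nondegenerate _ hz.1 _ fun a => ?_)
      (hh.nondegenerate _ hz.2 _ fun b => ?_)
    · simpa [warpedCoord_apply] using hX (a, 0)
    · simpa [warpedCoord_apply, hpos _ hz.1] using hX (0, b)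

variable [FiniteDimensional ℝ E₁] [FiniteDimensional ℝ E₂]

/-- The factors are coupled only through the derivative of $f$ in $f\,h$. The formula is checked by
pairing both sides with an arbitrary vector. -/
theorem christoffel_warpedCoord (hg : IsCoordMetric g U) (hf : ContDiffOn ℝ ∞ f U)
    (hpos : ∀ u ∈ U, f u ≠ 0) (hh : IsCoordMetric h V) {z : E₁ × E₂} (hz : z ∈ U ×ˢ V)
    (X Y : E₁ × E₂) :
    christoffel (warpedCoord g f h) z X Y =
      (christoffel g z.1 X.1 Y.1 - ((1 / 2) * h z.2 X.2 Y.2) • coordGradient g f z.1,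
        christoffel h z.2 X.2 Y.2
          + (1 / 2 * (f z.1)⁻¹) • (fderiv ℝ f z.1 X.1 • Y.2 + fderiv ℝ f z.1 Y.1 • X.2)) := by
  have hG := isCoordMetric_warpedCoord hg hf hpos hh
  have hd : ∀ A B C : E₁ × E₂, fderiv ℝ (warpedCoord g f h) z A B C =
      fderiv ℝ g z.1 A.1 B.1 C.1 + fderiv ℝ f z.1 A.1 * h z.2 B.2 C.2
        + f z.1 * fderiv ℝ h z.2 A.2 B.2 C.2 := by
    intro A B C
    have h1 := hG.hasFDerivAt_apply hz B C
    have hf' : HasFDerivAt f _ z.1 :=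
      ((hf.contDiffAt (hg.isOpen.mem_nhds hz.1)).differentiableAt (by simp)).hasFDerivAt
    have h2 := ((hg.hasFDerivAt_apply hz.1 B.1 C.1).comp z hasFDerivAt_fst).add
      ((hf'.comp z hasFDerivAt_fst).mul
        ((hh.hasFDerivAt_apply hz.2 B.2 C.2).comp z hasFDerivAt_snd))
    have h3 := h2.congr_of_eventuallyEq (f₁ := fun x => warpedCoord g f h x B C)
      (Filter.Eventually.of_forall fun x => by simp [warpedCoord_apply])
    have h4 := congrArg (fun L => L A) (h1.unique h3)
    simp at h4
    rw [h4]
    ring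
  refine hG.ext hz fun Z => ?_
  have hf0 := hpos _ hz.1
  rw [hG.apply_christoffel hz, hd, hd, hd, warpedCoord_apply]
  simp only [map_sub, map_add, map_smul, _root_.sub_apply, _root_.add_apply, _root_.smul_apply,
    smul_eq_mul, hg.apply_christoffel hz.1, hh.apply_christoffel hz.2,
    hg.apply_coordGradient hz.1]
  field_simp
  ring

/-- The derivative of the Christoffel symbols of a warped product. -/
theorem fderiv_christoffel_warpedCoord (hg : IsCoordMetric g U) (hf : ContDiffOn ℝ ∞ f U)
    (hpos : ∀ u ∈ U, f u ≠ 0) (hh : IsCoordMetric h V) {z : E₁ × E₂} (hz : z ∈ U ×ˢ V)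
    (A X Y : E₁ × E₂) :
    fderiv ℝ (christoffel (warpedCoord g f h)) z A X Y =
      (fderiv ℝ (christoffel g) z.1 A.1 X.1 Y.1
        - ((1 / 2) * h z.2 X.2 Y.2) • fderiv ℝ (coordGradient g f) z.1 A.1
        - ((1 / 2) * fderiv ℝ h z.2 A.2 X.2 Y.2) • coordGradient g f z.1,
        fderiv ℝ (christoffel h) z.2 A.2 X.2 Y.2
          + (1 / 2 * (f z.1)⁻¹) • (fderiv ℝ (fderiv ℝ f) z.1 A.1 X.1 • Y.2
            + fderiv ℝ (fderiv ℝ f) z.1 A.1 Y.1 • X.2)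
          - (1 / 2 * ((f z.1)⁻¹ ^ 2 * fderiv ℝ f z.1 A.1)) •
            (fderiv ℝ f z.1 X.1 • Y.2 + fderiv ℝ f z.1 Y.1 • X.2)) := by
  have hG := isCoordMetric_warpedCoord hg hf hpos hh
  have hfz := hf.contDiffAt (hg.isOpen.mem_nhds hz.1)
  have hf1 : HasFDerivAt f _ z.1 := (hfz.differentiableAt (by simp)).hasFDerivAt
  have hf2 : HasFDerivAt (fderiv ℝ f) _ z.1 :=
    ((hfz.fderiv_right (m := ∞) (by simp)).differentiableAt (by simp)).hasFDerivAt
  have hfX : ∀ a : E₁, HasFDerivAt (fun u => fderiv ℝ f u a) _ z.1 := fun a =>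
    hf2.clm_apply (hasFDerivAt_const a z.1)
  have hgr := (hg.differentiableAt_coordGradient hz.1 hfz).hasFDerivAt
  have hfi : HasFDerivAt (fun u => 1 / 2 * (f u)⁻¹) _ z.1 :=
    ((hasDerivAt_inv (hpos _ hz.1)).comp_hasFDerivAt z.1 hf1).const_mul (1 / 2)
  have h1 := hG.hasFDerivAt_christoffel_apply hz X Y
  have h2 := (((hg.hasFDerivAt_christoffel_apply hz.1 X.1 Y.1).comp z hasFDerivAt_fst).sub
    ((((hh.hasFDerivAt_apply hz.2 X.2 Y.2).const_mul (1 / 2)).comp z hasFDerivAt_snd).smul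
      (hgr.comp z hasFDerivAt_fst))).prodMk
    (((hh.hasFDerivAt_christoffel_apply hz.2 X.2 Y.2).comp z hasFDerivAt_snd).add
      ((hfi.comp z hasFDerivAt_fst).smul
        ((((hfX X.1).comp z hasFDerivAt_fst).smul_const Y.2).add
          (((hfX Y.1).comp z hasFDerivAt_fst).smul_const X.2))))
  -- The formula for the Christoffel symbols holds on an open set, so it may be differentiated.
  have h3 := h2.congr_of_eventuallyEq (f₁ := fun x => christoffel (warpedCoord g f h) x X Y)
    ((hG.isOpen.eventually_mem hz).mono fun x hx => christoffel_warpedCoord hg hf hpos hh hx X Y)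
  have h4 := congrArg (fun L => L A) (h1.unique h3)
  refine h4.trans (Prod.ext ?_ ?_)
  · simp
    module
  · simp
    module

/-- The endomorphism `T` of a warping function. -/
theorem sharp_warpTensor (hg : IsCoordMetric g U) {u : E₁} (hu : u ∈ U)
    (hf : ContDiffAt ℝ ∞ f u) (a : E₁) :
    sharp g u (warpTensor g f u) a = -(1 / 2 * (f u)⁻¹) •
      (fderiv ℝ (coordGradient g f) u a + christoffel g u a (coordGradient g f u)
        - (1 / 2 * (f u)⁻¹ * fderiv ℝ f u a) • coordGradient g f u) := by
  refine hg.ext hu fun b => ?_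
  rw [hg.apply_sharp hu, warpTensor_apply, ← hg.apply_nabla_coordGradient hu hf,
    ← hg.apply_coordGradient hu f b]
  simp only [map_sub, map_add, map_smul, _root_.sub_apply, _root_.add_apply, _root_.smul_apply,
    smul_eq_mul, one_div, mul_inv]
  ring

/-- The squared length of the gradient of `f`, divided by `4 f`. -/
def warpNorm (g : E₁ → E₁ →L[ℝ] E₁ →L[ℝ] ℝ) (f : E₁ → ℝ) (u : E₁) : ℝ :=
  fderiv ℝ f u (coordGradient g f u) / (4 * f u)

/-- The coefficient of the fiber metric in the Ricci tensor of a warped product with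
`d`-dimensional fiber. -/
def warpRicci (d : ℕ) (g : E₁ → E₁ →L[ℝ] E₁ →L[ℝ] ℝ) (f : E₁ → ℝ) (u : E₁) : ℝ :=
  f u * metricTrace g u (warpTensor g f u) - (d - 1) * warpNorm g f u

/-- The curvature operator of a warped product. -/
theorem curvOp_warpedCoord (hg : IsCoordMetric g U) (hf : ContDiffOn ℝ ∞ f U)
    (hpos : ∀ u ∈ U, f u ≠ 0) (hh : IsCoordMetric h V) {z : E₁ × E₂} (hz : z ∈ U ×ˢ V)
    (X Y Z : E₁ × E₂) :
    curvOp (warpedCoord g f h) z Y Z X =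
      (curvOp g z.1 Y.1 Z.1 X.1
        + (f z.1 * h z.2 Y.2 Z.2) • sharp g z.1 (warpTensor g f z.1) X.1
        - (f z.1 * h z.2 X.2 Z.2) • sharp g z.1 (warpTensor g f z.1) Y.1,
      curvOp h z.2 Y.2 Z.2 X.2
        + (warpTensor g f z.1 Y.1 Z.1
          - warpNorm g f z.1 * h z.2 Y.2 Z.2) • X.2
        - (warpTensor g f z.1 X.1 Z.1
          - warpNorm g f z.1 * h z.2 X.2 Z.2) • Y.2) := by
  have hf0 := hpos _ hz.1
  have hfz := hf.contDiffAt (hg.isOpen.mem_nhds hz.1)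
  -- The multiple of $Z$ in the fiber component contains the Hessian of $f$ antisymmetrized in $X,
  -- Y$, which must cancel.
  have hsymm : fderiv ℝ (fderiv ℝ f) z.1 X.1 Y.1 = fderiv ℝ (fderiv ℝ f) z.1 Y.1 X.1 :=
    (hfz.isSymmSndFDerivAt (by
      rw [minSmoothness_of_isRCLikeNormedField]; exact WithTop.coe_le_coe.2 le_top)) X.1 Y.1
  rw [curvOp_apply, curvOp_apply, curvOp_apply, sharp_warpTensor hg hz.1 hfz,
    sharp_warpTensor hg hz.1 hfz, warpTensor_apply, warpTensor_apply,
    warpNorm]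
  simp only [fderiv_christoffel_warpedCoord hg hf hpos hh hz,
    christoffel_warpedCoord hg hf hpos hh hz, hsymm, hh.fderiv_eq hz.2]
  refine Prod.ext ?_ ?_
  · simp only [Prod.fst_add, Prod.fst_sub, map_sub, map_add, map_smul, smul_eq_mul,
      hh.christoffel_symm hz.2 Y.2 X.2,
      hh.symm z.2 hz.2 Y.2 X.2]
    match_scalars <;> field_simp
    ring
  · simp only [Prod.snd_add, Prod.snd_sub, map_sub, map_add, map_smul, smul_eq_mul,
      hh.christoffel_symm hz.2 Y.2 X.2]
    match_scalars <;> field_simp <;> ring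

/-- Only the diagonal blocks contribute: split $L$ along the two projections and use cyclicity of
the trace. -/
theorem trace_prod {V₁ V₂ : Type*} [AddCommGroup V₁] [Module ℝ V₁] [FiniteDimensional ℝ V₁]
    [AddCommGroup V₂] [Module ℝ V₂] [FiniteDimensional ℝ V₂] (L : V₁ × V₂ →ₗ[ℝ] V₁ × V₂) :
    LinearMap.trace ℝ (V₁ × V₂) L =
      LinearMap.trace ℝ V₁ (LinearMap.fst ℝ V₁ V₂ ∘ₗ L ∘ₗ LinearMap.inl ℝ V₁ V₂)
        + LinearMap.trace ℝ V₂ (LinearMap.snd ℝ V₁ V₂ ∘ₗ L ∘ₗ LinearMap.inr ℝ V₁ V₂) := by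
  have h : L = (L ∘ₗ LinearMap.inl ℝ V₁ V₂) ∘ₗ LinearMap.fst ℝ V₁ V₂
      + (L ∘ₗ LinearMap.inr ℝ V₁ V₂) ∘ₗ LinearMap.snd ℝ V₁ V₂ := by
    refine LinearMap.ext fun x => ?_
    simp [← map_add]
  conv_lhs => rw [h, map_add]
  exact congrArg₂ (· + ·) (LinearMap.trace_comp_comm' _ _) (LinearMap.trace_comp_comm' _ _)

/-- The Ricci tensor of a warped product. -/
theorem ricci_warpedCoord (hg : IsCoordMetric g U) (hf : ContDiffOn ℝ ∞ f U)
    (hpos : ∀ u ∈ U, f u ≠ 0) (hh : IsCoordMetric h V) {z : E₁ × E₂} (hz : z ∈ U ×ˢ V)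
    (Y Z : E₁ × E₂) :
    ricci (warpedCoord g f h) z Y Z =
      ricci g z.1 Y.1 Z.1 + Module.finrank ℝ E₂ * warpTensor g f z.1 Y.1 Z.1
        + ricci h z.2 Y.2 Z.2
        + warpRicci (Module.finrank ℝ E₂) g f z.1 * h z.2 Y.2 Z.2 := by
  have h1 : LinearMap.fst ℝ E₁ E₂ ∘ₗ curvOp (warpedCoord g f h) z Y Z ∘ₗ LinearMap.inl ℝ E₁ E₂ =
      curvOp g z.1 Y.1 Z.1 + (f z.1 * h z.2 Y.2 Z.2) • sharp g z.1 (warpTensor g f z.1) :=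
    LinearMap.ext fun a => by simp [curvOp_warpedCoord hg hf hpos hh hz]
  -- The factor $d-1$ in `warpRicci` arises here: the identity has trace $d$, and the rank-one term
  -- takes one back.
  have h2 : LinearMap.snd ℝ E₁ E₂ ∘ₗ curvOp (warpedCoord g f h) z Y Z ∘ₗ LinearMap.inr ℝ E₁ E₂ =
      curvOp h z.2 Y.2 Z.2 + (warpTensor g f z.1 Y.1 Z.1 - warpNorm g f z.1 * h z.2 Y.2 Z.2) • LinearMap.id
        + warpNorm g f z.1 • ((met h z.2).flip Z.2).smulRight Y.2 :=
    LinearMap.ext fun b => by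
      simp [curvOp_warpedCoord hg hf hpos hh hz, met_apply, smul_smul]
  rw [ricci_apply, trace_prod, h1, h2]
  simp only [map_add, map_smul, LinearMap.trace_id, LinearMap.trace_smulRight, smul_eq_mul,
    ← ricci_apply, ← metricTrace_eq_trace_sharp, LinearMap.flip_apply, met_apply, warpRicci]
  ring

theorem riemann_warpedCoord (hg : IsCoordMetric g U) (hf : ContDiffOn ℝ ∞ f U)
    (hpos : ∀ u ∈ U, f u ≠ 0) (hh : IsCoordMetric h V) {z : E₁ × E₂} (hz : z ∈ U ×ˢ V)
    (X Y Z W : E₁ × E₂) :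
    riemann (warpedCoord g f h) z X Y Z W =
      riemann g z.1 X.1 Y.1 Z.1 W.1
        + f z.1 * h z.2 Y.2 Z.2 * warpTensor g f z.1 X.1 W.1
        - f z.1 * h z.2 X.2 Z.2 * warpTensor g f z.1 Y.1 W.1
        + f z.1 * (riemann h z.2 X.2 Y.2 Z.2 W.2
        + (warpTensor g f z.1 Y.1 Z.1
          - warpNorm g f z.1 * h z.2 Y.2 Z.2) * h z.2 X.2 W.2
        - (warpTensor g f z.1 X.1 Z.1
          - warpNorm g f z.1 * h z.2 X.2 Z.2)
            * h z.2 Y.2 W.2) := by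
  simp only [riemann, warpedCoord_apply, curvOp_warpedCoord hg hf hpos hh hz, map_add, map_sub,
    map_smul, _root_.add_apply, _root_.sub_apply, _root_.smul_apply, smul_eq_mul,
    hg.apply_sharp hz.1]

end

end WarpedCoordinates

/-! ### The second Bianchi identity and Schur's lemma. -/

section Schur

set_option maxSynthPendingDepth 3

variable {E : Type*} [NormedAddCommGroup E] [NormedSpace ℝ E] [FiniteDimensional ℝ E]

namespace IsCoordMetric

variable {G : E → E →L[ℝ] E →L[ℝ] ℝ} {U : Set E} {u : E}

/-- Supplies the derivatives for the Bianchi identity, and the differentiability of $R$ needed in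
Schur's lemma. -/
theorem hasFDerivAt_curvOp (hG : IsCoordMetric G U) (hu : u ∈ U) (X Y Z : E) :
    ∃ L : E →L[ℝ] E, HasFDerivAt (fun x => curvOp G x Y Z X) L u ∧ ∀ W, L W =
      fderiv ℝ (fderiv ℝ (christoffel G)) u W X Y Z - fderiv ℝ (fderiv ℝ (christoffel G)) u W Y X Z
        + fderiv ℝ (christoffel G) u W X (christoffel G u Y Z)
        + christoffel G u X (fderiv ℝ (christoffel G) u W Y Z)
        - fderiv ℝ (christoffel G) u W Y (christoffel G u X Z)
        - christoffel G u Y (fderiv ℝ (christoffel G) u W X Z) := by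
  have h1 := hG.contDiffAt_christoffel hu
  have hd1 := (hG.differentiableAt_christoffel hu).hasFDerivAt
  have hd2 : HasFDerivAt (fderiv ℝ (christoffel G)) _ u :=
    ((h1.fderiv_right (m := ∞) (by simp)).differentiableAt (by simp)).hasFDerivAt
  have hc : ∀ v : E, HasFDerivAt (fun _ : E => v) (0 : E →L[ℝ] E) u := fun v => hasFDerivAt_const v u
  have e1 : ∀ X Y : E, HasFDerivAt (fun x => fderiv ℝ (christoffel G) x X Y Z) _ u :=
    fun X Y => ((hd2.clm_apply (hc X)).clm_apply (hc Y)).clm_apply (hc Z)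
  have e2 : ∀ X Y : E, HasFDerivAt (fun x => christoffel G x X (christoffel G x Y Z)) _ u :=
    fun X Y => (hd1.clm_apply (hc X)).clm_apply (hG.hasFDerivAt_christoffel_apply hu Y Z)
  refine ⟨_, (((e1 X Y).sub (e1 Y X)).add (e2 X Y)).sub (e2 Y X), fun W => ?_⟩
  simp
  abel

/-- The second Bianchi identity. -/
theorem bianchi (hG : IsCoordMetric G U) (hu : u ∈ U) (W X Y Z : E) :
    fderiv ℝ (fun x => curvOp G x Y Z X) u W
      + christoffel G u W (curvOp G u Y Z X) - curvOp G u Y (christoffel G u W Z) X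
      + (fderiv ℝ (fun x => curvOp G x W Z Y) u X
        + christoffel G u X (curvOp G u W Z Y) - curvOp G u W (christoffel G u X Z) Y)
      + (fderiv ℝ (fun x => curvOp G x X Z W) u Y
        + christoffel G u Y (curvOp G u X Z W) - curvOp G u X (christoffel G u Y Z) W) = 0 := by
  -- Symmetry of second derivatives cancels the top-order terms of the cyclic sum. The terms of
  -- $\nabla R$ where $\Gamma$ acts on the two antisymmetric arguments are absent from the statement
  -- because they cancel cyclically.
  have hs : ∀ A B : E, fderiv ℝ (fderiv ℝ (christoffel G)) u A B =
      fderiv ℝ (fderiv ℝ (christoffel G)) u B A :=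
    (hG.contDiffAt_christoffel hu).isSymmSndFDerivAt (by
      rw [minSmoothness_of_isRCLikeNormedField]; exact WithTop.coe_le_coe.2 le_top)
  obtain ⟨L₁, h1, h1'⟩ := hG.hasFDerivAt_curvOp hu X Y Z
  obtain ⟨L₂, h2, h2'⟩ := hG.hasFDerivAt_curvOp hu Y W Z
  obtain ⟨L₃, h3, h3'⟩ := hG.hasFDerivAt_curvOp hu W X Z
  rw [h1.fderiv, h2.fderiv, h3.fderiv, h1', h2', h3', hs X W, hs Y W, hs Y X]
  simp only [curvOp_apply, map_add, map_sub]
  abel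

/-- Allows $R = cG$ to be solved for $c$. If $g\wedge g = 0$, then $g(X,W)Y = g(Y,W)X$, and tracing
in $Y$ gives $(n-1)g(X,W)=0$. -/
theorem exists_kn_met_ne_zero (hG : IsCoordMetric G U) (hu : u ∈ U)
    (hE : 2 ≤ Module.finrank ℝ E) :
    ∃ X Y Z W, 1 / 2 * kn (met G u) (met G u) X Y Z W ≠ 0 := by
  by_contra! hcon
  have h1 : ∀ X Y W, G u X W • Y = G u Y W • X := by
    intro X Y W
    refine hG.ext hu fun Z => ?_
    have := hcon X Y Z W
    simp only [kn, met_apply] at this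
    simp only [map_smul, _root_.smul_apply, smul_eq_mul]
    linarith
  have h2 : ∀ X W, G u X W = 0 := by
    intro X W
    have h3 : G u X W • LinearMap.id = ((met G u).flip W).smulRight X :=
      LinearMap.ext fun Y => h1 X Y W
    have h4 := congrArg (LinearMap.trace ℝ E) h3
    simp only [map_smul, LinearMap.trace_id, LinearMap.trace_smulRight, LinearMap.flip_apply,
      met_apply, smul_eq_mul] at h4
    have : (2 : ℝ) ≤ Module.finrank ℝ E := by exact_mod_cast hE
    have h5 : ((Module.finrank ℝ E : ℝ) - 1) * G u X W = 0 := by linear_combination h4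
    exact (mul_eq_zero.mp h5).resolve_left (by linarith)
  have : Nontrivial E := Module.nontrivial_of_finrank_pos (R := ℝ) (by omega)
  obtain ⟨v, hv⟩ := exists_ne (0 : E)
  exact hv (hG.nondegenerate u hu v (h2 v))

/-- **Schur's lemma** in coordinates: a pointwise constant sectional curvature has derivative
zero in dimension at least `3`. -/
theorem hasFDerivAt_zero_of_riemann_eq (hG : IsCoordMetric G U) {c : E → ℝ}
    (h : ∀ x ∈ U, ∀ X Y Z W, riemann G x X Y Z W =
      c x * (1 / 2 * kn (met G x) (met G x) X Y Z W))
    (hE : 3 ≤ Module.finrank ℝ E) (hu : u ∈ U) : HasFDerivAt c (0 : E →L[ℝ] ℝ) u := by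
  -- No regularity of $c$ is assumed: it is locally a quotient of a component of $R$ by a
  -- nonvanishing component of $\frac12 g\wedge g$.
  have hc : DifferentiableAt ℝ c u := by
    obtain ⟨X, Y, Z, W, hk⟩ := hG.exists_kn_met_ne_zero hu (by omega)
    have d1 : DifferentiableAt ℝ (fun x => riemann G x X Y Z W) u := by
      obtain ⟨L, hL, -⟩ := hG.hasFDerivAt_curvOp hu X Y Z
      exact ((hG.differentiableAt hu).clm_apply hL.differentiableAt).clm_apply
        (differentiableAt_const W)
    have dG : ∀ v w : E, DifferentiableAt ℝ (fun x => G x v w) u := fun v w =>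
      (hG.hasFDerivAt_apply hu v w).differentiableAt
    have d2 : DifferentiableAt ℝ (fun x => 1 / 2 * kn (met G x) (met G x) X Y Z W) u := by
      simp only [kn, met_apply]
      fun_prop (disch := assumption)
    refine (d1.fun_mul (d2.fun_inv hk)).congr_of_eventuallyEq ?_
    filter_upwards [hG.isOpen.eventually_mem hu, d2.continuousAt.eventually_ne hk] with x hx hx'
    rw [h x hx, mul_inv_cancel_right₀ hx']
  set D := fderiv ℝ c u with hD
  have hcurv : ∀ x ∈ U, ∀ X Y Z, curvOp G x Y Z X = c x • (G x Y Z • X - G x X Z • Y) :=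
    fun x hx => hG.curvOp_of_riemann_eq hx (h x hx)
  have hder : ∀ X Y Z W, fderiv ℝ (fun x => curvOp G x Y Z X) u W =
      D W • (G u Y Z • X - G u X Z • Y)
        + c u • (fderiv ℝ G u W Y Z • X - fderiv ℝ G u W X Z • Y) := by
    intro X Y Z W
    have e1 := hc.hasFDerivAt.smul (((hG.hasFDerivAt_apply hu Y Z).smul_const X).sub
      ((hG.hasFDerivAt_apply hu X Z).smul_const Y))
    have e2 := e1.congr_of_eventuallyEq (f₁ := fun x => curvOp G x Y Z X)
      ((hG.isOpen.eventually_mem hu).mono fun x hx => hcurv x hx X Y Z)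
    rw [e2.fderiv]
    simp [hD]
    abel
  -- In the Bianchi identity for $cG$ all terms containing $c$ itself cancel, since $\nabla G = 0$;
  -- only those with $dc$ remain.
  have key : ∀ W X Y Z, D X • (G u W Z • Y - G u Y Z • W) + D Y • (G u X Z • W - G u W Z • X)
      + D W • (G u Y Z • X - G u X Z • Y) = 0 := by
    intro W X Y Z
    have hb := hG.bianchi hu W X Y Z
    simp only [hder, hcurv u hu, hG.fderiv_eq hu, map_smul, map_sub] at hb
    rw [hG.christoffel_symm hu X W, hG.christoffel_symm hu Y W, hG.christoffel_symm hu Y X] at hb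
    rw [← hb]
    module
  -- Tracing `key` over $X$ produces the factor $n-2$. A second trace, over $Y$, then gives
  -- $(n-1)\,dc = 0$.
  have key2 : ∀ W Y, D W • Y = D Y • W := by
    intro W Y
    refine hG.ext hu fun Z => ?_
    have h3 : (D : E →ₗ[ℝ] ℝ).smulRight (G u W Z • Y - G u Y Z • W)
        + D Y • (((met G u).flip Z).smulRight W - G u W Z • LinearMap.id)
        + D W • (G u Y Z • LinearMap.id - ((met G u).flip Z).smulRight Y) = 0 :=
      LinearMap.ext fun X => by simpa [met_apply] using key W X Y Z
    have h4 := congrArg (LinearMap.trace ℝ E) h3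
    simp [met_apply] at h4
    have : (3 : ℝ) ≤ Module.finrank ℝ E := by exact_mod_cast hE
    have h5 : ((Module.finrank ℝ E : ℝ) - 2) * (D W * G u Y Z - D Y * G u W Z) = 0 := by
      linear_combination h4
    have h6 := (mul_eq_zero.mp h5).resolve_left (by linarith)
    simpa [sub_eq_zero] using h6
  have hD0 : D = 0 := by
    ext W
    have h3 : D W • LinearMap.id = (D : E →ₗ[ℝ] ℝ).smulRight W :=
      LinearMap.ext fun Y => key2 W Y
    have h4 := congrArg (LinearMap.trace ℝ E) h3
    simp only [map_smul, LinearMap.trace_id, LinearMap.trace_smulRight,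
      ContinuousLinearMap.coe_coe, smul_eq_mul] at h4
    have : (3 : ℝ) ≤ Module.finrank ℝ E := by exact_mod_cast hE
    have h5 : ((Module.finrank ℝ E : ℝ) - 1) * D W = 0 := by linear_combination h4
    exact (mul_eq_zero.mp h5).resolve_left (by linarith)
  rw [← hD0]
  exact hc.hasFDerivAt

end IsCoordMetric

end Schur

/-! ### Curvature depends only on the germ of the metric. -/

section Locality

variable {E : Type*} [NormedAddCommGroup E] [NormedSpace ℝ E]
  {G G' : E → E →L[ℝ] E →L[ℝ] ℝ} {u : E}

theorem christoffel_congr (h : G =ᶠ[nhds u] G') : christoffel G u = christoffel G' u := by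
  simp only [christoffel, christoffelFirst, h.eq_of_nhds, h.fderiv_eq]

theorem curvOp_congr (h : G =ᶠ[nhds u] G') (Y Z : E) : curvOp G u Y Z = curvOp G' u Y Z := by
  have h1 : christoffel G =ᶠ[nhds u] christoffel G' :=
    h.eventuallyEq_nhds.mono fun _ hx => christoffel_congr hx
  ext X
  simp only [curvOp_apply, h1.eq_of_nhds, h1.fderiv_eq]

theorem riemann_congr (h : G =ᶠ[nhds u] G') : riemann G u = riemann G' u := by
  ext X Y Z W
  simp only [riemann, h.eq_of_nhds, curvOp_congr h]

theorem ricci_congr (h : G =ᶠ[nhds u] G') : ricci G u = ricci G' u := by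
  ext Y Z
  simp only [ricci_apply, curvOp_congr h]

theorem met_congr (h : G u = G' u) : met G u = met G' u := by
  ext Y Z
  simp only [met_apply, h]

end Locality

/-! ### From a manifold to its charts; global form of Schur's lemma. -/

section Charts

variable {E : Type*} [NormedAddCommGroup E] [NormedSpace ℝ E]
  {H : Type*} [TopologicalSpace H] {I : ModelWithCorners ℝ E H}
  {M : Type*} [TopologicalSpace M] [ChartedSpace H M] {e : OpenPartialHomeomorph M H} {u : E}

theorem inChart_apply (g : (x : M) → TangentSpace I x →L[ℝ] TangentSpace I x →L[ℝ] ℝ) (X Y : E) :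
    inChart I g e u X Y = g ((e.extend I).symm u)
      (mfderiv 𝓘(ℝ, E) I (e.extend I).symm u X) (mfderiv 𝓘(ℝ, E) I (e.extend I).symm u Y) := rfl

variable [I.Boundaryless] [IsManifold I ∞ M]

omit [I.Boundaryless] in
theorem contMDiffOn_extend_symm_target (he : e ∈ atlas H M) :
    ContMDiffOn 𝓘(ℝ, E) I ∞ (e.extend I).symm (e.extend I).target := by
  rw [e.extend_target']
  exact contMDiffOn_extend_symm (IsManifold.subset_maximalAtlas he)

theorem mdifferentiableAt_extend_symm (he : e ∈ atlas H M) (hu : u ∈ (e.extend I).target) :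
    MDifferentiableAt 𝓘(ℝ, E) I (e.extend I).symm u :=
  ((contMDiffOn_extend_symm_target he).contMDiffAt
    (e.isOpen_extend_target.mem_nhds hu)).mdifferentiableAt (by simp)

/-- The chain rule for chart ∘ inverse chart = id gives the derivative a left inverse. -/
theorem injective_mfderiv_extend_symm (he : e ∈ atlas H M) (hu : u ∈ (e.extend I).target) :
    Function.Injective (mfderiv 𝓘(ℝ, E) I (e.extend I).symm u : E → E) := by
  have h1 := mdifferentiableAt_extend_symm he hu
  have hs : (e.extend I).symm u ∈ e.source := by
    rw [← e.extend_source (I := I)]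
    exact (e.extend I).map_target hu
  have h2 : MDifferentiableAt I 𝓘(ℝ, E) (e.extend I) ((e.extend I).symm u) :=
    (e.contMDiffAt_extend (n := ∞) (IsManifold.subset_maximalAtlas he) hs).mdifferentiableAt
      (by simp)
  have h3 := mfderiv_comp u h2 h1
  have h4 : (e.extend I) ∘ (e.extend I).symm =ᶠ[nhds u] id :=
    Filter.mem_of_superset (e.isOpen_extend_target.mem_nhds hu)
      fun x hx => (e.extend I).right_inv hx
  rw [h4.mfderiv_eq, mfderiv_id] at h3
  intro a b hab
  have h5 : ∀ x : E, x = mfderiv I 𝓘(ℝ, E) (e.extend I) ((e.extend I).symm u)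
      (mfderiv 𝓘(ℝ, E) I (e.extend I).symm u x) := fun x => congrArg (fun L => L x) h3
  exact (h5 a).trans ((congrArg _ hab).trans (h5 b).symm)

theorem IsSemiRiemannian.isCoordMetric [FiniteDimensional ℝ E]
    {g : (x : M) → TangentSpace I x →L[ℝ] TangentSpace I x →L[ℝ] ℝ} (hg : IsSemiRiemannian I g)
    (he : e ∈ atlas H M) : IsCoordMetric (inChart I g e) (e.extend I).target where
  isOpen := e.isOpen_extend_target
  contDiffOn := hg.smooth e he
  symm u _ v w := by simp only [inChart_apply]; exact hg.symm _ _ _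
  nondegenerate u hu v hv := by
    let L : E →L[ℝ] E := mfderiv 𝓘(ℝ, E) I (e.extend I).symm u
    have hinj : Function.Injective L := injective_mfderiv_extend_symm (I := I) he hu
    -- Nondegeneracy is tested against all tangent vectors, so each of them must come from a
    -- coordinate vector.
    have hsurj : Function.Surjective L.toLinearMap := LinearMap.surjective_of_injective hinj
    refine hinj ((hg.nondegenerate ((e.extend I).symm u) (L v) fun w => ?_).trans (map_zero L).symm)
    obtain ⟨w', rfl⟩ := hsurj w
    exact hv w'

theorem isConstantCurvature_of_hasCurvature [FiniteDimensional ℝ E] [ConnectedSpace M]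
    {g : (x : M) → TangentSpace I x →L[ℝ] TangentSpace I x →L[ℝ] ℝ} (hg : IsSemiRiemannian I g)
    {c : M → ℝ} (hc : HasCurvature I g c) (hE : Module.finrank ℝ E ≠ 2) :
    IsConstantCurvature I g := by
  rcases le_or_gt (Module.finrank ℝ E) 1 with h1 | h1
  -- In dimension at most one all vectors are proportional, hence $g\wedge g = 0$ and any constant
  -- serves.
  · refine ⟨0, fun e he u hu X Y Z W => ?_⟩
    obtain ⟨v, hv⟩ := finrank_le_one_iff.mp h1
    obtain ⟨a, rfl⟩ := hv X
    obtain ⟨b, rfl⟩ := hv Y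
    rw [hc e he u hu]
    simp only [kn, map_smul, LinearMap.smul_apply, smul_eq_mul]
    ring
  · have hloc : IsLocallyConstant c := by
      rw [IsLocallyConstant.iff_eventually_eq]
      intro y
      have hy : extChartAt I y y ∈ ((chartAt H y).extend I).target := mem_extChartAt_target y
      have hG := hg.isCoordMetric (chart_mem_atlas H y)
      have hder : ∀ u ∈ ((chartAt H y).extend I).target,
          HasFDerivAt (c ∘ ((chartAt H y).extend I).symm) (0 : E →L[ℝ] ℝ) u := fun u hu =>
        hG.hasFDerivAt_zero_of_riemann_eq (hc _ (chart_mem_atlas H y)) (by omega) hu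
      -- A ball is convex, so a vanishing derivative makes $c$ constant on it; connectedness of $M$
      -- then globalizes.
      obtain ⟨r, hr, hball⟩ := Metric.isOpen_iff.mp hG.isOpen _ hy
      have hconst : ∀ u ∈ Metric.ball (extChartAt I y y) r,
          c ((extChartAt I y).symm u) = c y := by
        intro u hu
        have := (convex_ball (extChartAt I y y) r).is_const_of_fderivWithin_eq_zero (𝕜 := ℝ)
          (f := c ∘ ((chartAt H y).extend I).symm)
          (fun x hx => (hder x (hball hx)).differentiableAt.differentiableWithinAt)
          (fun x hx => by
            rw [fderivWithin_of_isOpen Metric.isOpen_ball hx]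
            exact (hder x (hball hx)).fderiv) hu (Metric.mem_ball_self hr)
        refine this.trans (congrArg c (extChartAt_to_inv (I := I) y))
      filter_upwards [(continuousAt_extChartAt (I := I) y).eventually
        (Metric.ball_mem_nhds _ hr), extChartAt_source_mem_nhds (I := I) y] with z hz hz'
      rw [← hconst _ hz, (extChartAt I y).left_inv hz']
    obtain ⟨x₀⟩ := (inferInstance : Nonempty M)
    refine ⟨c x₀, fun e he u hu X Y Z W => ?_⟩
    rw [hc e he u hu, hloc.apply_eq_of_isPreconnected isPreconnected_univ
      (Set.mem_univ ((e.extend I).symm u)) (Set.mem_univ x₀)]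

end Charts

/-! ### Product charts, and the warped metric in them. -/

section ProductCharts

variable {E₁ : Type*} [NormedAddCommGroup E₁] [NormedSpace ℝ E₁]
  {H₁ : Type*} [TopologicalSpace H₁] {I₁ : ModelWithCorners ℝ E₁ H₁}
  {B : Type*} [TopologicalSpace B]
  {E₂ : Type*} [NormedAddCommGroup E₂] [NormedSpace ℝ E₂]
  {H₂ : Type*} [TopologicalSpace H₂] {I₂ : ModelWithCorners ℝ E₂ H₂}
  {F : Type*} [TopologicalSpace F]
  {e : OpenPartialHomeomorph B H₁} {e' : OpenPartialHomeomorph F H₂} {u : E₁} {v : E₂}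

theorem prod_mem_atlas [ChartedSpace H₁ B] [ChartedSpace H₂ F] (he : e ∈ atlas H₁ B)
    (he' : e' ∈ atlas H₂ F) : e.prod e' ∈ atlas (ModelProd H₁ H₂) (B × F) :=
  Set.mem_image2_of_mem he he'

theorem mem_extend_prod_target (hu : u ∈ (e.extend I₁).target) (hv : v ∈ (e'.extend I₂).target) :
    (u, v) ∈ ((e.prod e').extend (I₁.prod I₂)).target := by
  rw [OpenPartialHomeomorph.extend_prod]
  exact ⟨hu, hv⟩

theorem extend_prod_symm_apply (z : E₁ × E₂) :
    ((e.prod e').extend (I₁.prod I₂)).symm z =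
      ((e.extend I₁).symm z.1, (e'.extend I₂).symm z.2) := by
  rw [OpenPartialHomeomorph.extend_prod]
  rfl

end ProductCharts

section WarpedCharts

variable {E₁ : Type*} [NormedAddCommGroup E₁] [NormedSpace ℝ E₁]
  {H₁ : Type*} [TopologicalSpace H₁] {I₁ : ModelWithCorners ℝ E₁ H₁} [I₁.Boundaryless]
  {B : Type*} [TopologicalSpace B] [ChartedSpace H₁ B] [IsManifold I₁ ∞ B]
  {E₂ : Type*} [NormedAddCommGroup E₂] [NormedSpace ℝ E₂]
  {H₂ : Type*} [TopologicalSpace H₂] {I₂ : ModelWithCorners ℝ E₂ H₂} [I₂.Boundaryless]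
  {F : Type*} [TopologicalSpace F] [ChartedSpace H₂ F] [IsManifold I₂ ∞ F]
  (gB : (x : B) → TangentSpace I₁ x →L[ℝ] TangentSpace I₁ x →L[ℝ] ℝ) (f : B → ℝ)
  (gF : (y : F) → TangentSpace I₂ y →L[ℝ] TangentSpace I₂ y →L[ℝ] ℝ)
  {e : OpenPartialHomeomorph B H₁} {e' : OpenPartialHomeomorph F H₂} {u : E₁} {v : E₂}

/-- Chain rule applied to $\pi\circ(\text{product chart})^{-1} = (\text{base
chart})^{-1}\circ\mathrm{pr}_1$. -/
theorem mfderiv_fst_extend_prod_symm (he : e ∈ atlas H₁ B) (he' : e' ∈ atlas H₂ F)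
    (hu : u ∈ (e.extend I₁).target) (hv : v ∈ (e'.extend I₂).target) (X : E₁ × E₂) :
    (mfderiv (I₁.prod I₂) I₁ (Prod.fst : B × F → B)
        (((e.prod e').extend (I₁.prod I₂)).symm (u, v)) : E₁ × E₂ →L[ℝ] E₁)
      ((mfderiv 𝓘(ℝ, E₁ × E₂) (I₁.prod I₂) ((e.prod e').extend (I₁.prod I₂)).symm (u, v) :
        E₁ × E₂ →L[ℝ] E₁ × E₂) X) = (mfderiv 𝓘(ℝ, E₁) I₁ (e.extend I₁).symm u : E₁ →L[ℝ] E₁) X.1 := by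
  have h1 := mdifferentiableAt_extend_symm (I := I₁.prod I₂) (prod_mem_atlas he he')
    (mem_extend_prod_target hu hv)
  have h2 := mfderiv_comp (u, v) (mdifferentiableAt_fst (I := I₁) (I' := I₂)) h1
  have h3 : MDifferentiableAt 𝓘(ℝ, E₁ × E₂) 𝓘(ℝ, E₁) (Prod.fst : E₁ × E₂ → E₁) (u, v) :=
    differentiableAt_fst.mdifferentiableAt
  have h4 := mfderiv_comp (I := 𝓘(ℝ, E₁ × E₂)) (f := (Prod.fst : E₁ × E₂ → E₁)) (u, v)
    (mdifferentiableAt_extend_symm (I := I₁) he hu) h3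
  have h5 : (Prod.fst : B × F → B) ∘ ((e.prod e').extend (I₁.prod I₂)).symm =
      (e.extend I₁).symm ∘ (Prod.fst : E₁ × E₂ → E₁) := by
    funext z
    simp only [Function.comp_apply, extend_prod_symm_apply]
  rw [h5, h4, mfderiv_eq_fderiv, fderiv_fst] at h2
  exact (congrArg (fun L => L X) h2).symm

theorem mfderiv_snd_extend_prod_symm (he : e ∈ atlas H₁ B) (he' : e' ∈ atlas H₂ F)
    (hu : u ∈ (e.extend I₁).target) (hv : v ∈ (e'.extend I₂).target) (X : E₁ × E₂) :
    (mfderiv (I₁.prod I₂) I₂ (Prod.snd : B × F → F)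
        (((e.prod e').extend (I₁.prod I₂)).symm (u, v)) : E₁ × E₂ →L[ℝ] E₂)
      ((mfderiv 𝓘(ℝ, E₁ × E₂) (I₁.prod I₂) ((e.prod e').extend (I₁.prod I₂)).symm (u, v) :
        E₁ × E₂ →L[ℝ] E₁ × E₂) X) = (mfderiv 𝓘(ℝ, E₂) I₂ (e'.extend I₂).symm v : E₂ →L[ℝ] E₂) X.2 := by
  have h1 := mdifferentiableAt_extend_symm (I := I₁.prod I₂) (prod_mem_atlas he he')
    (mem_extend_prod_target hu hv)
  have h2 := mfderiv_comp (u, v) (mdifferentiableAt_snd (I := I₁) (I' := I₂)) h1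
  have h3 : MDifferentiableAt 𝓘(ℝ, E₁ × E₂) 𝓘(ℝ, E₂) (Prod.snd : E₁ × E₂ → E₂) (u, v) :=
    differentiableAt_snd.mdifferentiableAt
  have h4 := mfderiv_comp (I := 𝓘(ℝ, E₁ × E₂)) (f := (Prod.snd : E₁ × E₂ → E₂)) (u, v)
    (mdifferentiableAt_extend_symm (I := I₂) he' hv) h3
  have h5 : (Prod.snd : B × F → F) ∘ ((e.prod e').extend (I₁.prod I₂)).symm =
      (e'.extend I₂).symm ∘ (Prod.snd : E₁ × E₂ → E₂) := by
    funext z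
    simp only [Function.comp_apply, extend_prod_symm_apply]
  rw [h5, h4, mfderiv_eq_fderiv, fderiv_snd] at h2
  exact (congrArg (fun L => L X) h2).symm

theorem inChart_warpedMetric (he : e ∈ atlas H₁ B) (he' : e' ∈ atlas H₂ F)
    (hu : u ∈ (e.extend I₁).target) (hv : v ∈ (e'.extend I₂).target) :
    inChart (I₁.prod I₂) (warpedMetric I₁ I₂ gB f gF) (e.prod e') (u, v) =
      warpedCoord (inChart I₁ gB e) (f ∘ (e.extend I₁).symm) (inChart I₂ gF e') (u, v) := by
  refine ContinuousLinearMap.ext fun X => ContinuousLinearMap.ext fun Y => ?_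
  let D := mfderiv 𝓘(ℝ, E₁ × E₂) (I₁.prod I₂) ((e.prod e').extend (I₁.prod I₂)).symm (u, v)
  let P₁ : E₁ × E₂ → E₁ := fun X => mfderiv (I₁.prod I₂) I₁ (Prod.fst : B × F → B)
    (((e.prod e').extend (I₁.prod I₂)).symm (u, v)) (D X)
  let P₂ : E₁ × E₂ → E₂ := fun X => mfderiv (I₁.prod I₂) I₂ (Prod.snd : B × F → F)
    (((e.prod e').extend (I₁.prod I₂)).symm (u, v)) (D X)
  have h1 : ∀ X, P₁ X = mfderiv 𝓘(ℝ, E₁) I₁ (e.extend I₁).symm u X.1 :=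
    mfderiv_fst_extend_prod_symm he he' hu hv
  have h2 : ∀ X, P₂ X = mfderiv 𝓘(ℝ, E₂) I₂ (e'.extend I₂).symm v X.2 :=
    mfderiv_snd_extend_prod_symm he he' hu hv
  have h3 : inChart (I₁.prod I₂) (warpedMetric I₁ I₂ gB f gF) (e.prod e') (u, v) X Y =
      gB ((e.extend I₁).symm u) (P₁ X) (P₁ Y)
        + f ((e.extend I₁).symm u) * gF ((e'.extend I₂).symm v) (P₂ X) (P₂ Y) := rfl
  rw [h3, h1, h1, h2, h2, warpedCoord_apply]
  rfl

theorem inChart_warpedMetric_eventuallyEq (he : e ∈ atlas H₁ B) (he' : e' ∈ atlas H₂ F)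
    (hu : u ∈ (e.extend I₁).target) (hv : v ∈ (e'.extend I₂).target) :
    inChart (I₁.prod I₂) (warpedMetric I₁ I₂ gB f gF) (e.prod e') =ᶠ[nhds (u, v)]
      warpedCoord (inChart I₁ gB e) (f ∘ (e.extend I₁).symm) (inChart I₂ gF e') := by
  filter_upwards [(e.isOpen_extend_target.prod e'.isOpen_extend_target).mem_nhds
    (show (u, v) ∈ (e.extend I₁).target ×ˢ (e'.extend I₂).target from ⟨hu, hv⟩)] with z hz
  exact inChart_warpedMetric gB f gF he he' hz.1 hz.2

end WarpedCharts

/-! ### The Roter condition at a point, and its relation to conformal flatness. -/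

section PointwiseRoter

variable {E : Type*} [NormedAddCommGroup E] [NormedSpace ℝ E]

/-- The Roter type condition at the point `u` of a coordinate domain. -/
def RoterAt (G : E → E →L[ℝ] E →L[ℝ] ℝ) (u : E) (k₁ k₂ k₃ : ℝ) : Prop :=
  ∀ X Y Z W, riemann G u X Y Z W = k₁ * kn (met G u) (met G u) X Y Z W
    + k₂ * kn (met G u) (ricci G u) X Y Z W + k₃ * kn (ricci G u) (ricci G u) X Y Z W

theorem RoterAt.congr {G G' : E → E →L[ℝ] E →L[ℝ] ℝ} {u : E} {k₁ k₂ k₃ : ℝ}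
    (h : RoterAt G u k₁ k₂ k₃) (hG : G =ᶠ[nhds u] G') : RoterAt G' u k₁ k₂ k₃ := by
  intro X Y Z W
  rw [← riemann_congr hG, ← ricci_congr hG, ← met_congr hG.eq_of_nhds]
  exact h X Y Z W

theorem RoterAt.riemann_eq_of_ricci_eq {G : E → E →L[ℝ] E →L[ℝ] ℝ} {u : E} {k₁ k₂ k₃ c : ℝ}
    (h : RoterAt G u k₁ k₂ k₃) (hS : ricci G u = c • met G u) (X Y Z W : E) :
    riemann G u X Y Z W =
      (2 * (k₁ + k₂ * c + k₃ * c ^ 2)) * (1 / 2 * kn (met G u) (met G u) X Y Z W) := by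
  rw [h X Y Z W, hS]
  simp only [kn, LinearMap.smul_apply, smul_eq_mul]
  ring

variable [FiniteDimensional ℝ E] {G : E → E →L[ℝ] E →L[ℝ] ℝ} {U : Set E} {u : E}

/-- Makes (ii) an instance of the fiber computation, with third scalar zero. -/
theorem roterAt_of_conformalCurv_eq_zero (h : ∀ X Y Z W, conformalCurv G u X Y Z W = 0) :
    RoterAt G u (-(scalarCurv G u /
        (2 * ((Module.finrank ℝ E : ℝ) - 1) * ((Module.finrank ℝ E : ℝ) - 2))))
      (1 / ((Module.finrank ℝ E : ℝ) - 2)) 0 := by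
  intro X Y Z W
  have := h X Y Z W
  simp only [conformalCurv] at this
  linear_combination this

namespace IsCoordMetric

theorem scalarCurv_of_riemann_eq (hG : IsCoordMetric G U) (hu : u ∈ U) {c : ℝ}
    (h : ∀ X Y Z W, riemann G u X Y Z W = c * (1 / 2 * kn (met G u) (met G u) X Y Z W)) :
    scalarCurv G u = c * (Module.finrank ℝ E - 1) * Module.finrank ℝ E := by
  rw [scalarCurv, hG.ricci_of_riemann_eq hu h, metricTrace_smul, hG.metricTrace_met hu]

theorem conformalCurv_of_riemann_eq (hG : IsCoordMetric G U) (hu : u ∈ U) {c : ℝ}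
    (h : ∀ X Y Z W, riemann G u X Y Z W = c * (1 / 2 * kn (met G u) (met G u) X Y Z W))
    (hE : 3 ≤ Module.finrank ℝ E) (X Y Z W : E) : conformalCurv G u X Y Z W = 0 := by
  have h3 : (3 : ℝ) ≤ Module.finrank ℝ E := by exact_mod_cast hE
  have h1 : (Module.finrank ℝ E : ℝ) - 1 ≠ 0 := by linarith
  have h2 : (Module.finrank ℝ E : ℝ) - 2 ≠ 0 := by linarith
  rw [conformalCurv, h, hG.scalarCurv_of_riemann_eq hu h, hG.ricci_of_riemann_eq hu h]
  simp only [kn, LinearMap.smul_apply, smul_eq_mul]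
  field_simp
  ring

theorem ricci_eq_of_riemann_eq (hG : IsCoordMetric G U) (hu : u ∈ U) {c : ℝ}
    (h : ∀ X Y Z W, riemann G u X Y Z W = c * (1 / 2 * kn (met G u) (met G u) X Y Z W))
    (hE : Module.finrank ℝ E ≠ 0) (X Y : E) :
    ricci G u X Y = scalarCurv G u / Module.finrank ℝ E * G u X Y := by
  have h1 : (Module.finrank ℝ E : ℝ) ≠ 0 := by exact_mod_cast hE
  rw [hG.scalarCurv_of_riemann_eq hu h, hG.ricci_of_riemann_eq hu h, mul_div_cancel_right₀ _ h1]
  rfl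

end IsCoordMetric

end PointwiseRoter

/-! ### Fiber, base and mixed components of the Roter identity. -/

section WarpedComponents

variable {E₁ : Type*} [NormedAddCommGroup E₁] [NormedSpace ℝ E₁] [FiniteDimensional ℝ E₁]
  {E₂ : Type*} [NormedAddCommGroup E₂] [NormedSpace ℝ E₂] [FiniteDimensional ℝ E₂]

variable {g : E₁ → E₁ →L[ℝ] E₁ →L[ℝ] ℝ} {f : E₁ → ℝ} {h : E₂ → E₂ →L[ℝ] E₂ →L[ℝ] ℝ}
  {U : Set E₁} {V : Set E₂} {z : E₁ × E₂} {k₁ k₂ k₃ : ℝ}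

/-- On fiber vectors $g = f h$, $S = \tilde S + q h$ and $R = f(\tilde R - \frac{\nu}{2} h\wedge
h)$. The scalars result from expanding and dividing by $f$. -/
theorem roterAt_fiber (hg : IsCoordMetric g U) (hf : ContDiffOn ℝ ∞ f U)
    (hpos : ∀ u ∈ U, f u ≠ 0) (hh : IsCoordMetric h V) (hz : z ∈ U ×ˢ V)
    (hR : RoterAt (warpedCoord g f h) z k₁ k₂ k₃) :
    RoterAt h z.2
      (warpNorm g f z.1 / 2 + k₁ * f z.1 + k₂ * warpRicci (Module.finrank ℝ E₂) g f z.1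
        + k₃ * warpRicci (Module.finrank ℝ E₂) g f z.1 ^ 2 / f z.1)
      (k₂ + 2 * k₃ * warpRicci (Module.finrank ℝ E₂) g f z.1 / f z.1) (k₃ / f z.1) := by
  intro X Y Z W
  have h1 := hR (0, X) (0, Y) (0, Z) (0, W)
  have hf0 := hpos _ hz.1
  simp only [riemann_warpedCoord hg hf hpos hh hz, kn, met_apply, warpedCoord_apply,
    riemann_zero_third, 
    ricci_warpedCoord hg hf hpos hh hz, map_zero, 
    mul_zero, zero_add, add_zero, zero_sub, sub_zero] at h1
  simp only [kn, met_apply]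
  field_simp
  linear_combination 2 * h1

theorem roterAt_base (hg : IsCoordMetric g U) (hf : ContDiffOn ℝ ∞ f U)
    (hpos : ∀ u ∈ U, f u ≠ 0) (hh : IsCoordMetric h V) (hz : z ∈ U ×ˢ V)
    (hR : RoterAt (warpedCoord g f h) z k₁ k₂ k₃) {α β γ : ℝ} (hα : α ≠ 0)
    (hT : ∀ X Y, α * warpTensor g f z.1 X Y + β * g z.1 X Y + γ * ricci g z.1 X Y = 0)
    {s t : ℝ} (hs : s = -(Module.finrank ℝ E₂ * β / α))
    (ht : t = 1 - Module.finrank ℝ E₂ * γ / α) :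
    RoterAt g z.1 (k₁ + k₂ * s + k₃ * s ^ 2) (k₂ * t + 2 * k₃ * s * t) (k₃ * t ^ 2) := by
  -- On base vectors $S = \bar S + dT$. Solving the relation for $T$ turns this into $s\,\bar g +
  -- t\,\bar S$, while $R = \bar R$.
  have hT' : ∀ X Y, ricci g z.1 X Y + Module.finrank ℝ E₂ * warpTensor g f z.1 X Y =
      s * g z.1 X Y + t * ricci g z.1 X Y := by
    intro X Y
    rw [hs, ht]
    field_simp
    linear_combination (Module.finrank ℝ E₂ : ℝ) * hT X Y
  intro X Y Z W
  have h1 := hR (X, 0) (Y, 0) (Z, 0) (W, 0)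
  simp only [riemann_warpedCoord hg hf hpos hh hz, kn, met_apply, warpedCoord_apply,
    riemann_zero_third, zero_mul,
    ricci_warpedCoord hg hf hpos hh hz, map_zero, hT',
    mul_zero, add_zero, sub_zero] at h1
  simp only [kn, met_apply]
  linear_combination h1

/-- The mixed components of the Roter type condition, traced over the base. -/
theorem ricci_fiber_eq (hg : IsCoordMetric g U) (hf : ContDiffOn ℝ ∞ f U)
    (hpos : ∀ u ∈ U, f u ≠ 0) (hh : IsCoordMetric h V) (hz : z ∈ U ×ˢ V)
    (hR : RoterAt (warpedCoord g f h) z k₁ k₂ k₃) {τ σ : ℝ}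
    (hτ : τ = metricTrace g z.1 (warpTensor g f z.1))
    (hσ : σ = scalarCurv g z.1 + Module.finrank ℝ E₂ * τ)
    (hne : k₂ * Module.finrank ℝ E₁ + 2 * k₃ * σ ≠ 0) :
    ricci h z.2 = ((f z.1 * τ - 2 * k₁ * Module.finrank ℝ E₁ * f z.1 - k₂ * f z.1 * σ)
        / (k₂ * Module.finrank ℝ E₁ + 2 * k₃ * σ) - warpRicci (Module.finrank ℝ E₂) g f z.1)
      • met h z.2 := by
  ext Y Z
  set q := warpRicci (Module.finrank ℝ E₂) g f z.1 with hq
  -- With $Y, Z$ fixed in the fiber, the identity becomes one between bilinear forms on the base,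
  -- ready to be traced.
  have h1 : (f z.1 * h z.2 Y Z) • warpTensor g f z.1 =
      (2 * k₁ * f z.1 * h z.2 Y Z + k₂ * (ricci h z.2 Y Z + q * h z.2 Y Z)) • met g z.1
      + (k₂ * f z.1 * h z.2 Y Z + 2 * k₃ * (ricci h z.2 Y Z + q * h z.2 Y Z)) •
        (ricci g z.1 + (Module.finrank ℝ E₂ : ℝ) • warpTensor g f z.1) := by
    ext X W
    have h1 := hR (X, 0) (0, Y) (0, Z) (W, 0)
    simp only [riemann_warpedCoord hg hf hpos hh hz, kn, met_apply, warpedCoord_apply,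
    riemann_zero_first, riemann_zero_third, 
      ricci_warpedCoord hg hf hpos hh hz, map_zero, _root_.zero_apply,
      LinearMap.zero_apply, mul_zero, zero_add, add_zero, sub_zero] at h1
    simp only [LinearMap.smul_apply, LinearMap.add_apply, smul_eq_mul, met_apply]
    linear_combination h1
  have h2 := congrArg (metricTrace g z.1) h1
  simp only [metricTrace_add, metricTrace_smul, hg.metricTrace_met hz.1, ← hτ] at h2
  -- After the trace, $\tilde S + q h$ is multiplied by $k_2 p + 2k_3\sigma$, with $\sigma$ the
  -- trace of $\bar S + dT$; this is solved for $\tilde S$.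
  rw [← scalarCurv, ← hσ] at h2
  simp only [LinearMap.smul_apply, smul_eq_mul, met_apply]
  rw [sub_mul, div_mul_eq_mul_div, eq_sub_iff_add_eq, eq_div_iff hne]
  linear_combination -h2

end WarpedComponents

/-! ### Scalar invariants of the warping function, in preferred charts. -/

section WarpInvariants

variable {E : Type*} [NormedAddCommGroup E] [NormedSpace ℝ E] [FiniteDimensional ℝ E]
  {H : Type*} [TopologicalSpace H] {I : ModelWithCorners ℝ E H}
  {B : Type*} [TopologicalSpace B] [ChartedSpace H B]

/-- The quantity `|df|² / (4 f)` at `x`, in the preferred chart. -/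
def warpNormAt (g : (x : B) → TangentSpace I x →L[ℝ] TangentSpace I x →L[ℝ] ℝ) (f : B → ℝ)
    (x : B) : ℝ :=
  warpNorm (inChart I g (chartAt H x)) (f ∘ (extChartAt I x).symm) (extChartAt I x x)

/-- The coefficient of the fiber metric in the Ricci tensor of a warped product at `x`, with
`d`-dimensional fiber. -/
def warpRicciAt (d : ℕ) (g : (x : B) → TangentSpace I x →L[ℝ] TangentSpace I x →L[ℝ] ℝ)
    (f : B → ℝ) (x : B) : ℝ :=
  f x * trWarpAt I g f x - (d - 1) * warpNormAt g f x

/-- The trace over the base of the Ricci tensor of a warped product at `x`, with `d`-dimensional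
fiber. -/
def warpScalarAt (d : ℕ) (g : (x : B) → TangentSpace I x →L[ℝ] TangentSpace I x →L[ℝ] ℝ)
    (f : B → ℝ) (x : B) : ℝ :=
  scalarCurvAt I g x + d * trWarpAt I g f x

theorem warpRicci_extChartAt (d : ℕ)
    (g : (x : B) → TangentSpace I x →L[ℝ] TangentSpace I x →L[ℝ] ℝ) (f : B → ℝ) (x : B) :
    warpRicci d (inChart I g (chartAt H x)) (f ∘ (extChartAt I x).symm) (extChartAt I x x) =
      warpRicciAt d g f x := by
  simp only [warpRicci, warpRicciAt, Function.comp_apply, extChartAt_to_inv]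
  rfl

end WarpInvariants

section PointwiseConstantCurvature

variable {E : Type*} [NormedAddCommGroup E] [NormedSpace ℝ E]
  {H : Type*} [TopologicalSpace H] {I : ModelWithCorners ℝ E H}
  {M : Type*} [TopologicalSpace M] [ChartedSpace H M]
  {g : (x : M) → TangentSpace I x →L[ℝ] TangentSpace I x →L[ℝ] ℝ}

theorem IsRoterTypeWith.hasCurvature {N₁ N₂ N₃ l : M → ℝ} (h : IsRoterTypeWith I g N₁ N₂ N₃)
    (hS : ∀ e ∈ atlas H M, ∀ u ∈ (e.extend I).target,
      ricci (inChart I g e) u = l ((e.extend I).symm u) • met (inChart I g e) u) :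
    HasCurvature I g (fun x => 2 * (N₁ x + N₂ x * l x + N₃ x * l x ^ 2)) :=
  fun e he u hu => RoterAt.riemann_eq_of_ricci_eq (h e he u hu) (hS e he u hu)

end PointwiseConstantCurvature

/-! ### Transfer of the pointwise results to the manifolds. -/

section WarpedManifolds

variable {E₁ : Type*} [NormedAddCommGroup E₁] [NormedSpace ℝ E₁] [FiniteDimensional ℝ E₁]
  {H₁ : Type*} [TopologicalSpace H₁] {I₁ : ModelWithCorners ℝ E₁ H₁} [I₁.Boundaryless]
  {B : Type*} [TopologicalSpace B] [ChartedSpace H₁ B] [IsManifold I₁ ∞ B]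
  {E₂ : Type*} [NormedAddCommGroup E₂] [NormedSpace ℝ E₂] [FiniteDimensional ℝ E₂]
  {H₂ : Type*} [TopologicalSpace H₂] {I₂ : ModelWithCorners ℝ E₂ H₂} [I₂.Boundaryless]
  {F : Type*} [TopologicalSpace F] [ChartedSpace H₂ F] [IsManifold I₂ ∞ F]
  {gB : (x : B) → TangentSpace I₁ x →L[ℝ] TangentSpace I₁ x →L[ℝ] ℝ} {f : B → ℝ}
  {gF : (y : F) → TangentSpace I₂ y →L[ℝ] TangentSpace I₂ y →L[ℝ] ℝ}
  {e : OpenPartialHomeomorph B H₁} {e' : OpenPartialHomeomorph F H₂} {u : E₁} {v : E₂}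

omit [FiniteDimensional ℝ E₁] [I₁.Boundaryless] in
theorem contDiffOn_comp_extend_symm (hf : ContMDiff I₁ 𝓘(ℝ, ℝ) ∞ f) (he : e ∈ atlas H₁ B) :
    ContDiffOn ℝ ∞ (f ∘ (e.extend I₁).symm) (e.extend I₁).target :=
  contMDiffOn_iff_contDiffOn.mp
    (hf.comp_contMDiffOn (contMDiffOn_extend_symm_target he))

omit [FiniteDimensional ℝ E₁] [FiniteDimensional ℝ E₂] in
theorem IsRoterTypeWith.roterAt_warpedCoord {N₁ N₂ N₃ : B × F → ℝ}
    (hR : IsRoterTypeWith (I₁.prod I₂) (warpedMetric I₁ I₂ gB f gF) N₁ N₂ N₃)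
    (he : e ∈ atlas H₁ B) (he' : e' ∈ atlas H₂ F) (hu : u ∈ (e.extend I₁).target)
    (hv : v ∈ (e'.extend I₂).target) :
    RoterAt (warpedCoord (inChart I₁ gB e) (f ∘ (e.extend I₁).symm) (inChart I₂ gF e')) (u, v)
      (N₁ ((e.extend I₁).symm u, (e'.extend I₂).symm v))
      (N₂ ((e.extend I₁).symm u, (e'.extend I₂).symm v))
      (N₃ ((e.extend I₁).symm u, (e'.extend I₂).symm v)) := by
  refine RoterAt.congr (fun X Y Z W => ?_)
    (inChart_warpedMetric_eventuallyEq gB f gF he he' hu hv)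
  have := hR _ (prod_mem_atlas he he') _ (mem_extend_prod_target hu hv) X Y Z W
  rwa [extend_prod_symm_apply] at this

omit [FiniteDimensional ℝ E₁] [FiniteDimensional ℝ E₂] in
theorem IsRoterTypeWith.roterAt_preferred {N₁ N₂ N₃ : B × F → ℝ}
    (hR : IsRoterTypeWith (I₁.prod I₂) (warpedMetric I₁ I₂ gB f gF) N₁ N₂ N₃)
    (he' : e' ∈ atlas H₂ F) (x : B) (hv : v ∈ (e'.extend I₂).target) :
    RoterAt (warpedCoord (inChart I₁ gB (chartAt H₁ x)) (f ∘ (extChartAt I₁ x).symm)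
        (inChart I₂ gF e')) (extChartAt I₁ x x, v)
      (N₁ (x, (e'.extend I₂).symm v)) (N₂ (x, (e'.extend I₂).symm v))
      (N₃ (x, (e'.extend I₂).symm v)) := by
  have := hR.roterAt_warpedCoord (chart_mem_atlas H₁ x) he' (mem_extChartAt_target (I := I₁) x) hv
  rwa [← extChartAt, extChartAt_to_inv] at this

/-- The fiber of a warped product of Roter type is of Roter type.  The base point `x y` may depend
on the point `y` of the fiber. -/
theorem isRoterTypeWith_fiber (hgB : IsSemiRiemannian I₁ gB) (hgF : IsSemiRiemannian I₂ gF)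
    (hf : ContMDiff I₁ 𝓘(ℝ, ℝ) ∞ f) (hpos : ∀ x, 0 < f x) {N₁ N₂ N₃ : B × F → ℝ}
    (hR : IsRoterTypeWith (I₁.prod I₂) (warpedMetric I₁ I₂ gB f gF) N₁ N₂ N₃) (x : F → B)
    {q : F → ℝ} (hq : ∀ y, q y = warpRicciAt (Module.finrank ℝ E₂) gB f (x y)) :
    IsRoterTypeWith I₂ gF
      (fun y => warpNormAt gB f (x y) / 2 + N₁ (x y, y) * f (x y) + N₂ (x y, y) * q y
        + N₃ (x y, y) * q y ^ 2 / f (x y))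
      (fun y => N₂ (x y, y) + 2 * N₃ (x y, y) * q y / f (x y))
      (fun y => N₃ (x y, y) / f (x y)) := by
  intro e' he' v hv
  set b := x ((e'.extend I₂).symm v) with hb
  have h1 := roterAt_fiber (hgB.isCoordMetric (chart_mem_atlas H₁ b))
    (contDiffOn_comp_extend_symm hf (chart_mem_atlas H₁ b)) (fun u _ => (hpos _).ne')
    (hgF.isCoordMetric he') (Set.mk_mem_prod (mem_extChartAt_target (I := I₁) b) hv)
    (hR.roterAt_preferred he' b hv)
  rw [← extChartAt, warpRicci_extChartAt, ← hq] at h1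
  simp only [Function.comp_apply, extChartAt_to_inv] at h1
  exact h1

/-- The fiber of a conformally flat warped product is conformally flat. -/
theorem isConformallyFlat_fiber (hgB : IsSemiRiemannian I₁ gB) (hgF : IsSemiRiemannian I₂ gF)
    (hf : ContMDiff I₁ 𝓘(ℝ, ℝ) ∞ f) (hpos : ∀ x, 0 < f x) [Nonempty B]
    (hE : Module.finrank ℝ E₁ ≠ 0)
    (hC : IsConformallyFlat (I₁.prod I₂) (warpedMetric I₁ I₂ gB f gF)) :
    IsConformallyFlat I₂ gF := by
  intro h3 e' he' v hv
  obtain ⟨x⟩ := (inferInstance : Nonempty B)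
  have hG := hgF.isCoordMetric he'
  have h1 := roterAt_of_conformalCurv_eq_zero (hC (by rw [Module.finrank_prod]; omega) _
    (prod_mem_atlas (chart_mem_atlas H₁ x) he') _
    (mem_extend_prod_target (mem_extChartAt_target (I := I₁) x) hv))
  have h2 := roterAt_fiber (hgB.isCoordMetric (chart_mem_atlas H₁ x))
    (contDiffOn_comp_extend_symm hf (chart_mem_atlas H₁ x)) (fun u _ => (hpos _).ne')
    hG (Set.mk_mem_prod (mem_extChartAt_target (I := I₁) x) hv)
    (h1.congr (inChart_warpedMetric_eventuallyEq gB f gF (chart_mem_atlas H₁ x) he'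
      (mem_extChartAt_target (I := I₁) x) hv))
  simp only [mul_zero, zero_mul, zero_div, add_zero] at h2
  have h4 : (3 : ℝ) ≤ Module.finrank ℝ E₂ := by exact_mod_cast h3
  have h5 : (1 : ℝ) ≤ Module.finrank ℝ E₁ := by exact_mod_cast Nat.one_le_iff_ne_zero.mpr hE
  -- The excluded case $(d-2)/(p+d-2) = 1$ would force $p = 0$.
  obtain ⟨c, hc⟩ := hG.ricci_of_riemann_eq_add hv
    (fun X Y Z W => by simpa only [zero_mul, add_zero] using h2 X Y Z W) (by
      rw [Module.finrank_prod]
      push_cast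
      rw [div_mul_eq_mul_div, one_mul, Ne, div_eq_one_iff_eq (by linarith)]
      intro h
      linarith)
  exact hG.conformalCurv_of_riemann_eq hv (h2.riemann_eq_of_ricci_eq hc) h3

/-- The base of a warped product of Roter type is of Roter type if `T` is a combination of the
metric and the Ricci tensor. -/
theorem isRoterTypeWith_base (hgB : IsSemiRiemannian I₁ gB) (hgF : IsSemiRiemannian I₂ gF)
    (hf : ContMDiff I₁ 𝓘(ℝ, ℝ) ∞ f) (hpos : ∀ x, 0 < f x) {N₁ N₂ N₃ : B × F → ℝ}
    (hR : IsRoterTypeWith (I₁.prod I₂) (warpedMetric I₁ I₂ gB f gF) N₁ N₂ N₃)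
    {α β γ : B → ℝ} (hα : ∀ x, α x ≠ 0) (hT : WarpRelation I₁ gB f α β γ) (y : F) {s t : B → ℝ}
    (hs : ∀ x, s x = -(Module.finrank ℝ E₂ * β x / α x))
    (ht : ∀ x, t x = 1 - Module.finrank ℝ E₂ * γ x / α x) :
    IsRoterTypeWith I₁ gB
      (fun x => N₁ (x, y) + N₂ (x, y) * s x + N₃ (x, y) * s x ^ 2)
      (fun x => N₂ (x, y) * t x + 2 * N₃ (x, y) * s x * t x) (fun x => N₃ (x, y) * t x ^ 2) := by
  intro e he u hu
  have hv := mem_extChartAt_target (I := I₂) y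
  have h1 := roterAt_base (hgB.isCoordMetric he) (contDiffOn_comp_extend_symm hf he)
    (fun u _ => (hpos _).ne') (hgF.isCoordMetric (chart_mem_atlas H₂ y)) (Set.mk_mem_prod hu hv)
    (hR.roterAt_warpedCoord he (chart_mem_atlas H₂ y) hu hv) (hα _) (hT e he u hu) (hs _) (ht _)
  rwa [← extChartAt, extChartAt_to_inv] at h1

/-- If the Roter type condition determines the Ricci tensor of the fiber, then the fiber has
pointwise constant sectional curvature. -/
theorem exists_hasCurvature_fiber (hgB : IsSemiRiemannian I₁ gB) (hgF : IsSemiRiemannian I₂ gF)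
    (hf : ContMDiff I₁ 𝓘(ℝ, ℝ) ∞ f) (hpos : ∀ x, 0 < f x) {N₁ N₂ N₃ : B × F → ℝ}
    (hR : IsRoterTypeWith (I₁.prod I₂) (warpedMetric I₁ I₂ gB f gF) N₁ N₂ N₃)
    (hne : ∀ y, ∃ x, N₂ (x, y) * Module.finrank ℝ E₁
      + 2 * N₃ (x, y) * warpScalarAt (Module.finrank ℝ E₂) gB f x ≠ 0) :
    ∃ c : F → ℝ, HasCurvature I₂ gF c := by
  -- The base point varies with $y$ without any regularity; Schur's lemma needs none of the
  -- resulting $c$.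
  choose x hx using hne
  refine ⟨_, (isRoterTypeWith_fiber hgB hgF hf hpos hR x (fun _ => rfl)).hasCurvature
    (l := fun y => (f (x y) * trWarpAt I₁ gB f (x y)
      - 2 * N₁ (x y, y) * Module.finrank ℝ E₁ * f (x y)
      - N₂ (x y, y) * f (x y) * warpScalarAt (Module.finrank ℝ E₂) gB f (x y))
      / (N₂ (x y, y) * Module.finrank ℝ E₁
        + 2 * N₃ (x y, y) * warpScalarAt (Module.finrank ℝ E₂) gB f (x y))
      - warpRicciAt (Module.finrank ℝ E₂) gB f (x y)) fun e' he' v hv => ?_⟩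
  set b := x ((e'.extend I₂).symm v) with hb
  have h1 := ricci_fiber_eq (hgB.isCoordMetric (chart_mem_atlas H₁ b))
    (contDiffOn_comp_extend_symm hf (chart_mem_atlas H₁ b)) (fun u _ => (hpos _).ne')
    (hgF.isCoordMetric he') (Set.mk_mem_prod (mem_extChartAt_target (I := I₁) b) hv)
    (hR.roterAt_preferred he' b hv) (τ := trWarpAt I₁ gB f b)
    (σ := warpScalarAt (Module.finrank ℝ E₂) gB f b) rfl rfl (hx _)
  rw [← extChartAt, warpRicci_extChartAt] at h1
  simp only [Function.comp_apply, extChartAt_to_inv] at h1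
  exact h1

/-- Pointwise constant sectional curvature implies the Einstein condition. -/
theorem isEinstein_of_hasCurvature (hgF : IsSemiRiemannian I₂ gF) {c : F → ℝ}
    (hc : HasCurvature I₂ gF c) (hE : Module.finrank ℝ E₂ ≠ 0) : IsEinstein I₂ gF :=
  fun e' he' v hv => (hgF.isCoordMetric he').ricci_eq_of_riemann_eq hv (hc e' he' v hv) hE

end WarpedManifolds

end WarpedRoter

end

theorem corollary5p3 (p d : ℕ) (hp : 1 ≤ p) (hd : 1 ≤ d) (hn : 3 ≤ p + d)
    (B : Type*) [TopologicalSpace B] [ChartedSpace (EuclideanSpace ℝ (Fin p)) B]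
    [IsManifold (𝓡 p) ∞ B] [ConnectedSpace B]
    (F : Type*) [TopologicalSpace F] [ChartedSpace (EuclideanSpace ℝ (Fin d)) F]
    [IsManifold (𝓡 d) ∞ F] [ConnectedSpace F]
    (gB : (x : B) → TangentSpace (𝓡 p) x →L[ℝ] TangentSpace (𝓡 p) x →L[ℝ] ℝ)
    (hgB : WarpedRoter.IsSemiRiemannian (𝓡 p) gB)
    (gF : (y : F) → TangentSpace (𝓡 d) y →L[ℝ] TangentSpace (𝓡 d) y →L[ℝ] ℝ)
    (hgF : WarpedRoter.IsSemiRiemannian (𝓡 d) gF)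
    (f : B → ℝ) (hf : ContMDiff (𝓡 p) 𝓘(ℝ, ℝ) ∞ f) (hfpos : ∀ x, 0 < f x)
    (hflat : ¬ WarpedRoter.IsFlat ((𝓡 p).prod (𝓡 d))
      (WarpedRoter.warpedMetric (𝓡 p) (𝓡 d) gB f gF))
    (N₁ N₂ N₃ : B × F → ℝ)
    (hR : WarpedRoter.IsRoterTypeWith ((𝓡 p).prod (𝓡 d))
      (WarpedRoter.warpedMetric (𝓡 p) (𝓡 d) gB f gF) N₁ N₂ N₃) :
    -- (i) the fiber is of Roter type (with smooth scalars if those of `M` are smooth)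
    (∃ K₁ K₂ K₃ : F → ℝ, WarpedRoter.IsRoterTypeWith (𝓡 d) gF K₁ K₂ K₃ ∧
      (ContMDiff ((𝓡 p).prod (𝓡 d)) 𝓘(ℝ, ℝ) ∞ N₁ → ContMDiff ((𝓡 p).prod (𝓡 d)) 𝓘(ℝ, ℝ) ∞ N₂ →
        ContMDiff ((𝓡 p).prod (𝓡 d)) 𝓘(ℝ, ℝ) ∞ N₃ →
        ContMDiff (𝓡 d) 𝓘(ℝ, ℝ) ∞ K₁ ∧ ContMDiff (𝓡 d) 𝓘(ℝ, ℝ) ∞ K₂ ∧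
          ContMDiff (𝓡 d) 𝓘(ℝ, ℝ) ∞ K₃)) ∧
    -- (ii) the fiber is conformally flat if `M` is
    (WarpedRoter.IsConformallyFlat ((𝓡 p).prod (𝓡 d))
        (WarpedRoter.warpedMetric (𝓡 p) (𝓡 d) gB f gF) →
      WarpedRoter.IsConformallyFlat (𝓡 d) gF) ∧
    -- (iii) constant curvature and Einstein condition for the fiber
    ((∀ y : F, ∃ x : B,
        -2 * (d : ℝ) * N₃ (x, y) * WarpedRoter.trWarpAt (𝓡 p) gB f x - N₂ (x, y) * (p : ℝ)
          - 2 * N₃ (x, y) * WarpedRoter.scalarCurvAt (𝓡 p) gB x ≠ 0) →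
      (∃ c : F → ℝ, WarpedRoter.HasCurvature (𝓡 d) gF c) ∧
      (d ≠ 2 → WarpedRoter.IsConstantCurvature (𝓡 d) gF) ∧
      WarpedRoter.IsEinstein (𝓡 d) gF) ∧
    -- (iv) the base is of Roter type if `α T + β gB + γ S = 0` with `α ≠ 0`
    (∀ α β γ : B → ℝ, (∀ x, α x ≠ 0) → WarpedRoter.WarpRelation (𝓡 p) gB f α β γ →
      ∃ K₁ K₂ K₃ : B → ℝ, WarpedRoter.IsRoterTypeWith (𝓡 p) gB K₁ K₂ K₃ ∧
        (ContMDiff ((𝓡 p).prod (𝓡 d)) 𝓘(ℝ, ℝ) ∞ N₁ →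
          ContMDiff ((𝓡 p).prod (𝓡 d)) 𝓘(ℝ, ℝ) ∞ N₂ →
          ContMDiff ((𝓡 p).prod (𝓡 d)) 𝓘(ℝ, ℝ) ∞ N₃ →
          ContMDiff (𝓡 p) 𝓘(ℝ, ℝ) ∞ α → ContMDiff (𝓡 p) 𝓘(ℝ, ℝ) ∞ β →
          ContMDiff (𝓡 p) 𝓘(ℝ, ℝ) ∞ γ →
          ContMDiff (𝓡 p) 𝓘(ℝ, ℝ) ∞ K₁ ∧ ContMDiff (𝓡 p) 𝓘(ℝ, ℝ) ∞ K₂ ∧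
            ContMDiff (𝓡 p) 𝓘(ℝ, ℝ) ∞ K₃)) := by
  have hp' : Module.finrank ℝ (EuclideanSpace ℝ (Fin p)) = p := finrank_euclideanSpace_fin
  have hd' : Module.finrank ℝ (EuclideanSpace ℝ (Fin d)) = d := finrank_euclideanSpace_fin
  obtain ⟨x₀⟩ := (inferInstance : Nonempty B)
  obtain ⟨y₀⟩ := (inferInstance : Nonempty F)
  refine ⟨?_, ?_, ?_, ?_⟩
  -- With a constant base point, the invariants of $f$ are constants and the $N_i$ are restricted to
  -- the slice $\{x_0\}\times F$, so smoothness is inherited.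
  · refine ⟨_, _, _, WarpedRoter.isRoterTypeWith_fiber hgB hgF hf hfpos hR (fun _ => x₀)
      (fun _ => rfl), fun h₁ h₂ h₃ => ?_⟩
    have hι : ContMDiff (𝓡 d) ((𝓡 p).prod (𝓡 d)) ∞ fun y : F => (x₀, y) :=
      contMDiff_const.prodMk contMDiff_id
    have s₁ := h₁.comp hι
    have s₂ := h₂.comp hι
    have s₃ := h₃.comp hι
    simp only [div_eq_mul_inv]
    exact ⟨((contMDiff_const.add (s₁.mul contMDiff_const)).add (s₂.mul contMDiff_const)).add
        ((s₃.mul contMDiff_const).mul contMDiff_const),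
      s₂.add (((contMDiff_const.mul s₃).mul contMDiff_const).mul contMDiff_const),
      s₃.mul contMDiff_const⟩
  · exact WarpedRoter.isConformallyFlat_fiber hgB hgF hf hfpos (by omega)
  · intro h
    obtain ⟨c, hc⟩ := WarpedRoter.exists_hasCurvature_fiber hgB hgF hf hfpos hR fun y => by
      obtain ⟨x, hx⟩ := h y
      refine ⟨x, fun h0 => hx ?_⟩
      rw [hp', hd', WarpedRoter.warpScalarAt] at h0
      -- The expression in (iii) is $-(N_2\,p + 2N_3(\bar\kappa + d\,\mathrm{tr}\,T))$, minus the
      -- denominator of `ricci_fiber_eq`.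
      linear_combination -h0
    exact ⟨⟨c, hc⟩, fun h2 => WarpedRoter.isConstantCurvature_of_hasCurvature hgF hc (by omega),
      WarpedRoter.isEinstein_of_hasCurvature hgF hc (by omega)⟩
  · intro α β γ hα hT
    -- The $N_i$ are restricted to the slice $B\times\{y_0\}$; the other ingredients are quotients
    -- by the nonvanishing $\alpha$.
    refine ⟨_, _, _, WarpedRoter.isRoterTypeWith_base hgB hgF hf hfpos hR hα hT y₀
      (fun _ => rfl) (fun _ => rfl), fun h₁ h₂ h₃ hα' hβ hγ => ?_⟩
    have hι : ContMDiff (𝓡 p) ((𝓡 p).prod (𝓡 d)) ∞ fun x : B => (x, y₀) :=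
      contMDiff_id.prodMk contMDiff_const
    have s₁ := h₁.comp hι
    have s₂ := h₂.comp hι
    have s₃ := h₃.comp hι
    have hs := ((contMDiff_const (c := (Module.finrank ℝ (EuclideanSpace ℝ (Fin d)) : ℝ))).mul
      hβ).div₀ hα' hα |>.neg
    have ht := (contMDiff_const (c := (1 : ℝ))).sub
      (((contMDiff_const (c := (Module.finrank ℝ (EuclideanSpace ℝ (Fin d)) : ℝ))).mul
        hγ).div₀ hα' hα)
    exact ⟨(s₁.add (s₂.mul hs)).add (s₃.mul (hs.pow 2)),
      (s₂.mul ht).add (((contMDiff_const.mul s₃).mul hs).mul ht), s₃.mul (ht.pow 2)⟩
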